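/- Let $\beta>0$ and $\kappa>0$. There is a constant $C>0$, depending only on $\beta$ and $\kappa$, such that the following holds. Let $G=(V,E)$ be an arbitrary connected undirected graph on $n=|V|<\infty$ nodes, with a distinguished root node $1\in V$ and diameter $\mathrm{Diam}(G)$. Let the signals $x^\star_v\in\mathbb{R}^d$, $v\in V$, be $(G,s,s')$-sparse, that is, $|\mathrm{Supp}(x^\star_1)|\le s$ and $|\mathrm{Supp}(x^\star_v-x^\star_w)|\le s'$ for every edge $(v,w)\in E$. Let $A_v=\frac{1}{\sqrt{N_v}}\widetilde A_v\in\mathbb{R}^{N_v\times d}$, $v\in V$, where the random matrices $\widetilde A_v$ are independent of each other and each of them has i.i.d. sub-Gaussian entries, that is, entries $X$ with $\mathbb{E}X=0$, $\mathbb{E}X^2=1$ and $\mathbb{P}(|X|\ge t)\le\beta e^{-\kappa t^2}$ for all $t\ge0$. Let $0<\epsilon<1$. If $$N_1\ \ge\ C\,\max\{s,\ n^2\,\mathrm{Diam}(G)\,s'\}\,\big(\log d+\log(1/\epsilon)\big)$$ and $$N_v\ \ge\ C\,n\,\mathrm{Diam}(G)\,s'\,\big(\log d+\log(n/\epsilon)\big)\quad\text{for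 every } v\in V\setminus\{1\},$$ then with probability greater than $1-\epsilon$ the Total Variation Basis Pursuit problem over the star graph on $V$ centred at the root, $$\min_{(x_v)_{v\in V}}\ \|x_1\|_1+\sum_{v\in V\setminus\{1\}}\|x_v-x_1\|_1\quad\text{subject to}\quad A_vx_v=A_vx^\star_v\ \text{ for all } v\in V,$$ has a unique solution, and this solution is $x_v=x^\star_v$ for all $v\in V$. -/

import Mathlib

open MeasureTheory ProbabilityTheory

/-- The `ℓ¹` norm of a vector in `ℝ^d`. -/
def l1Norm {d : ℕ} (x : Fin d → ℝ) : ℝ :=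
  ∑ j, |x j|

/-- The support of a vector in `ℝ^d`. -/
def supp {d : ℕ} (x : Fin d → ℝ) : Set (Fin d) :=
  {j | x j ≠ 0}

/-- `(G, s, s')`-sparsity of a collection of signals with respect to the root `r`: the root signal
has at most `s` nonzero entries, and the difference along every edge of `G` has at most `s'`. -/
def IsGraphSparse {V : Type*} {d : ℕ} (G : SimpleGraph V) (r : V) (s s' : ℕ)
    (x : V → Fin d → ℝ) : Prop :=
  (supp (x r)).ncard ≤ s ∧ ∀ v w, G.Adj v w → (supp (x v - x w)).ncard ≤ s'

/-- The `ℓ¹` norm of the difference of the signals at the two endpoints of an edge. -/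
def edgeL1 {V : Type*} {d : ℕ} (x : V → Fin d → ℝ) : Sym2 V → ℝ :=
  Sym2.lift ⟨fun v w => l1Norm (x v - x w), fun v w => by
    simp only [l1Norm, Pi.sub_apply]
    exact Finset.sum_congr rfl fun j _ => abs_sub_comm _ _⟩

open Classical in
/-- The objective of Total Variation Basis Pursuit over the graph `H` with root `r`:
`‖x_r‖₁ + ∑_{(v,w) ∈ E(H)} ‖x_v - x_w‖₁`, each undirected edge being counted once. -/
noncomputable def tvObjective {V : Type*} [Fintype V] {d : ℕ} (H : SimpleGraph V) (r : V)
    (x : V → Fin d → ℝ) : ℝ :=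
  l1Norm (x r) + ∑ e ∈ H.edgeFinset, edgeL1 x e

/-- The constraints of Total Variation Basis Pursuit: `A_v x_v = y_v` for every node `v`. -/
def IsTVBPFeasible {V : Type*} {N : V → ℕ} {d : ℕ}
    (A : ∀ v, Matrix (Fin (N v)) (Fin d) ℝ) (y : ∀ v, Fin (N v) → ℝ)
    (x : V → Fin d → ℝ) : Prop :=
  ∀ v, (A v).mulVec (x v) = y v

/-- `x` is a solution of the Total Variation Basis Pursuit problem over `H` with root `r`,
design matrices `A` and responses `y`. -/
def IsTVBPSolution {V : Type*} [Fintype V] {N : V → ℕ} {d : ℕ} (H : SimpleGraph V) (r : V)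
    (A : ∀ v, Matrix (Fin (N v)) (Fin d) ℝ) (y : ∀ v, Fin (N v) → ℝ)
    (x : V → Fin d → ℝ) : Prop :=
  IsTVBPFeasible A y x ∧ ∀ z, IsTVBPFeasible A y z → tvObjective H r x ≤ tvObjective H r z

/-- A family of independent sub-Gaussian random matrices with parameters `β`, `κ`: all the entries
of all the matrices are mutually independent, the entries of each matrix are identically
distributed, and every entry has mean zero, variance one and tails `P(|X| ≥ t) ≤ β exp(-κ t²)`. -/
structure IsSubGaussianFamily {V Ω : Type*} [MeasurableSpace Ω] {N : V → ℕ} {d : ℕ}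
    (β κ : ℝ) (μ : Measure Ω) (M : ∀ v, Ω → Matrix (Fin (N v)) (Fin d) ℝ) : Prop where
  indep : iIndepFun
    (fun (p : Σ v, Fin (N v) × Fin d) (ω : Ω) => M p.1 ω p.2.1 p.2.2) μ
  identDistrib : ∀ v i j i' j',
    IdentDistrib (fun ω => M v ω i j) (fun ω => M v ω i' j') μ μ
  mean_zero : ∀ v i j, ∫ ω, M v ω i j ∂μ = 0
  variance_one : ∀ v i j, ∫ ω, (M v ω i j) ^ 2 ∂μ = 1
  tail : ∀ v i j (t : ℝ), 0 ≤ t →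
    μ.real {ω | t ≤ |M v ω i j|} ≤ β * Real.exp (-κ * t ^ 2)

/-- The normalized design matrices `A_v = N_v^{-1/2} M_v` at a sample point. -/
noncomputable def normalizedDesign {V Ω : Type*} {N : V → ℕ} {d : ℕ}
    (M : ∀ v, Ω → Matrix (Fin (N v)) (Fin d) ℝ) (ω : Ω) (v : V) :
    Matrix (Fin (N v)) (Fin d) ℝ :=
  (1 / Real.sqrt (N v)) • M v ω

/-!
Let `z` be feasible with objective at most that of `x`, and put `h = z r - x r` and
`w v = z v - x v - h` for the leaves `v` of the star. Comparing objectives shows that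
`‖h‖₁ + ∑ ‖w v‖₁` is at most twice the sum of the masses of `h` on the support of `x r` and of the
`w v` on the supports of `x v - x r`, which have at most `Diam(G) s'` elements. Feasibility gives
`A r h = 0`, so a restricted eigenvalue condition for `A r` makes `‖h‖₂` small compared with
`‖h‖₁`. It also gives `‖A v (w v)‖₂ = ‖A v h‖₂`, so a restricted eigenvalue condition for each
`A v` controls the mass of `w v` by `‖A v h‖₂`, and a restricted upper bound for the one quadratic
form `∑ ‖A v h‖₂²` makes the sum of these terms at most `‖h‖₁ / 5`. Hence `h` and all `w v` vanish.

By Maurey's empirical method each restricted bound follows from energy bounds on sums of signed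
basis vectors. There are only `(2 d)ᵏ` such sums of length `k`, and the energy of a fixed vector
concentrates exponentially, so a union bound applies. The leaves enter the upper bound only through
their sum, whose exponential rate grows with their total number of measurements: this is why each
leaf needs only one factor `n` although the sparsity level involved is `n² Diam(G) s'`.
-/

section ExpInequalities

lemma exp_le_add_exp_sq (x : ℝ) : Real.exp x ≤ x + Real.exp (x ^ 2) := by
  have hsq := Real.add_one_le_exp (x ^ 2)
  rcases le_total |x| 1 with h | h
  · have := (abs_le.1 (Real.abs_exp_sub_one_sub_id_le h)).2
    linarith
  · rcases le_abs'.1 h with h | h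
    · have : Real.exp x ≤ 1 := Real.exp_le_one_iff.2 (by linarith)
      nlinarith
    · have : Real.exp x ≤ Real.exp (x ^ 2) := Real.exp_le_exp.2 (by nlinarith)
      linarith

lemma exp_neg_le_one_sub_add_sq {y : ℝ} (hy : 0 ≤ y) :
    Real.exp (-y) ≤ 1 - y + y ^ 2 / 2 := by
  have hquad := Real.quadratic_le_exp_of_nonneg hy
  have hpos : 0 < 1 - y + y ^ 2 / 2 := by nlinarith [sq_nonneg (y - 1)]
  rw [Real.exp_neg, inv_le_iff_one_le_mul₀ (Real.exp_pos _)]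
  calc 1 ≤ (1 - y + y ^ 2 / 2) * (1 + y + y ^ 2 / 2) := by nlinarith [sq_nonneg (y ^ 2)]
    _ ≤ (1 - y + y ^ 2 / 2) * Real.exp y := by gcongr

lemma exp_mul_le_of_le {l m : ℝ} (hl : 0 < l) (hm : 0 ≤ m) (hml : m ≤ l) (y : ℝ) :
    Real.exp (m * y) ≤ (1 - m / l) + m / l * Real.exp (l * y) := by
  have hratio : m / l ≤ 1 := (div_le_one hl).2 hml
  have := convexOn_exp.2 (Set.mem_univ 0) (Set.mem_univ (l * y)) (sub_nonneg.2 hratio)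
    (show 0 ≤ m / l by positivity) (by ring)
  simp only [smul_eq_mul, mul_zero, zero_add, Real.exp_zero, mul_one] at this
  rwa [← mul_assoc, div_mul_cancel₀ _ hl.ne'] at this

lemma exp_mul_le_exp_mul_exp_sq {l : ℝ} (hl : 0 < l) (t x : ℝ) :
    Real.exp (t * x) ≤ Real.exp (t ^ 2 / (4 * l)) * Real.exp (l * x ^ 2) := by
  rw [← Real.exp_add, Real.exp_le_exp, ← sub_nonneg,
    show t ^ 2 / (4 * l) + l * x ^ 2 - t * x = (t / 2 - l * x) ^ 2 / l by field_simp; ring]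
  positivity

end ExpInequalities

section ExponentialMoments

/-- The exponential moment of order `l` of the square of `X` is at most `K`. For some `l > 0` this
is a bound on the `ψ₂`-norm of `X`. -/
structure HasExpSqMoment {Ω : Type*} [MeasurableSpace Ω] (X : Ω → ℝ) (l K : ℝ) (μ : Measure Ω) :
    Prop where
  aemeasurable : AEMeasurable X μ
  integrable : Integrable (fun ω => Real.exp (l * X ω ^ 2)) μ
  integral_le : ∫ ω, Real.exp (l * X ω ^ 2) ∂μ ≤ K

variable {Ω : Type*} [MeasurableSpace Ω] {μ : Measure Ω} {X : Ω → ℝ}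
  {l K : ℝ}

namespace HasExpSqMoment

lemma integrable_exp_mul_sq_of_le (h : HasExpSqMoment X l K μ) {m : ℝ} (hml : m ≤ l) :
    Integrable (fun ω => Real.exp (m * X ω ^ 2)) μ := by
  have := h.aemeasurable
  refine h.integrable.mono' (by fun_prop) (ae_of_all _ fun ω => ?_)
  rw [Real.norm_eq_abs, Real.abs_exp]
  gcongr

lemma memLp_two (h : HasExpSqMoment X l K μ) (hl : 0 < l) : MemLp X 2 μ := by
  have := h.aemeasurable
  refine (memLp_two_iff_integrable_sq this.aestronglyMeasurable).2 ?_
  refine (h.integrable.const_mul l⁻¹).mono' (by fun_prop) (ae_of_all _ fun ω => ?_)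
  rw [Real.norm_eq_abs, abs_sq, ← mul_le_mul_iff_right₀ hl, mul_inv_cancel_left₀ hl.ne']
  linarith [Real.add_one_le_exp (l * X ω ^ 2)]

lemma integrable_exp_mul (h : HasExpSqMoment X l K μ) (hl : 0 < l) (t : ℝ) :
    Integrable (fun ω => Real.exp (t * X ω)) μ := by
  have := h.aemeasurable
  refine (h.integrable.const_mul (Real.exp (t ^ 2 / (4 * l)))).mono' (by fun_prop)
    (ae_of_all _ fun ω => ?_)
  rw [Real.norm_eq_abs, Real.abs_exp]
  exact exp_mul_le_exp_mul_exp_sq hl t _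

lemma mgf_le (h : HasExpSqMoment X l K μ) (hl : 0 < l) (t : ℝ) :
    mgf X μ t ≤ Real.exp (t ^ 2 / (4 * l) + (K - 1)) :=
  calc mgf X μ t ≤ ∫ ω, Real.exp (t ^ 2 / (4 * l)) * Real.exp (l * X ω ^ 2) ∂μ :=
        integral_mono (h.integrable_exp_mul hl t) (h.integrable.const_mul _)
          fun ω => exp_mul_le_exp_mul_exp_sq hl t _
    _ ≤ Real.exp (t ^ 2 / (4 * l)) * K := by
        rw [integral_const_mul]
        gcongr
        exact h.integral_le
    _ ≤ Real.exp (t ^ 2 / (4 * l)) * Real.exp (K - 1) := by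
        gcongr
        linarith [Real.add_one_le_exp (K - 1)]
    _ = Real.exp (t ^ 2 / (4 * l) + (K - 1)) := (Real.exp_add _ _).symm

end HasExpSqMoment

variable [IsProbabilityMeasure μ]

lemma lintegral_ofReal_le_one_add_of_measureReal_ge_le {f : Ω → ℝ} (hf : AEMeasurable f μ)
    (hf0 : ∀ ω, 0 ≤ f ω) {β : ℝ} (hβ : 0 ≤ β)
    (htail : ∀ u, 1 < u → μ.real {ω | u ≤ f ω} ≤ β * u ^ (-2 : ℝ)) :
    ∫⁻ ω, ENNReal.ofReal (f ω) ∂μ ≤ ENNReal.ofReal (1 + β) := by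
  rw [lintegral_eq_lintegral_meas_le μ (ae_of_all _ hf0) hf,
    ← Set.Ioc_union_Ioi_eq_Ioi (zero_le_one' ℝ),
    lintegral_union measurableSet_Ioi (Set.Ioc_disjoint_Ioi le_rfl),
    ENNReal.ofReal_add zero_le_one hβ]
  refine add_le_add ?_ ?_
  · calc ∫⁻ u in Set.Ioc (0 : ℝ) 1, μ {ω | u ≤ f ω}
        ≤ ∫⁻ _ in Set.Ioc (0 : ℝ) 1, 1 := lintegral_mono fun _ => prob_le_one
      _ = ENNReal.ofReal 1 := by simp
  · calc ∫⁻ u in Set.Ioi (1 : ℝ), μ {ω | u ≤ f ω}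
        ≤ ∫⁻ u in Set.Ioi (1 : ℝ), ENNReal.ofReal (β * u ^ (-2 : ℝ)) :=
          setLIntegral_mono' measurableSet_Ioi fun u hu => by
            rw [← ofReal_measureReal]
            exact ENNReal.ofReal_le_ofReal (htail u hu)
      _ = ENNReal.ofReal (∫ u in Set.Ioi (1 : ℝ), β * u ^ (-2 : ℝ)) := by
          refine (ofReal_integral_eq_lintegral_ofReal ?_ ?_).symm
          · exact (integrableOn_Ioi_rpow_of_lt (by norm_num) zero_lt_one).const_mul β
          · filter_upwards [ae_restrict_mem measurableSet_Ioi] with u hu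
            have : (0 : ℝ) < u := zero_lt_one.trans hu
            positivity
      _ = ENNReal.ofReal β := by
          rw [integral_const_mul, integral_Ioi_rpow_of_lt (by norm_num) zero_lt_one]
          norm_num

lemma HasExpSqMoment.of_tail (hX : AEMeasurable X μ) {β κ : ℝ} (hβ : 0 ≤ β) (hκ : 0 < κ)
    (htail : ∀ t : ℝ, 0 ≤ t → μ.real {ω | t ≤ |X ω|} ≤ β * Real.exp (-κ * t ^ 2)) :
    HasExpSqMoment X (κ / 2) (1 + β) μ := by
  have hm : AEMeasurable (fun ω => Real.exp (κ / 2 * X ω ^ 2)) μ := by fun_prop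
  have hnn : ∀ ω, 0 ≤ Real.exp (κ / 2 * X ω ^ 2) := fun ω => (Real.exp_pos _).le
  have hexp_tail : ∀ u : ℝ, 1 < u →
      μ.real {ω | u ≤ Real.exp (κ / 2 * X ω ^ 2)} ≤ β * u ^ (-2 : ℝ) := by
    intro u hu
    have hu0 : 0 < u := by linarith
    have hlog : 0 < Real.log u := Real.log_pos hu
    have hsub : {ω | u ≤ Real.exp (κ / 2 * X ω ^ 2)} ⊆ {ω | √(2 / κ * Real.log u) ≤ |X ω|} := by
      intro ω hω
      rw [Set.mem_ofPred_eq, ← Real.log_le_iff_le_exp hu0] at hω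
      rw [Set.mem_ofPred_eq, ← Real.sqrt_sq_eq_abs]
      apply Real.sqrt_le_sqrt
      rw [div_mul_eq_mul_div, div_le_iff₀ hκ]
      linarith
    calc μ.real {ω | u ≤ Real.exp (κ / 2 * X ω ^ 2)}
        ≤ β * Real.exp (-κ * √(2 / κ * Real.log u) ^ 2) :=
          (measureReal_mono hsub).trans (htail _ (Real.sqrt_nonneg _))
      _ = β * u ^ (-2 : ℝ) := by
          rw [Real.sq_sqrt (by positivity), Real.rpow_def_of_pos hu0]
          congr 2
          field_simp
  have hlint := lintegral_ofReal_le_one_add_of_measureReal_ge_le hm hnn hβ hexp_tail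
  refine ⟨hX, ⟨hm.aestronglyMeasurable, ?_⟩, ?_⟩
  · rw [hasFiniteIntegral_iff_ofReal (ae_of_all _ hnn)]
    exact hlint.trans_lt ENNReal.ofReal_lt_top
  · rw [integral_eq_lintegral_of_nonneg_ae (ae_of_all _ hnn) hm.aestronglyMeasurable]
    exact ENNReal.toReal_le_of_le_ofReal (by linarith) hlint

lemma hasExpSqMoment_of_hasSubgaussianMGF {c : NNReal} (hc : 0 < c) (hX : HasSubgaussianMGF X c μ) :
    HasExpSqMoment X (1 / (4 * c)) 3 μ := by
  have : (0 : ℝ) < c := hc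
  have htail : ∀ t : ℝ, 0 ≤ t →
      μ.real {ω | t ≤ |X ω|} ≤ 2 * Real.exp (-(1 / (2 * c)) * t ^ 2) := by
    intro t ht
    have hsub : {ω | t ≤ |X ω|} ⊆ {ω | t ≤ X ω} ∪ {ω | t ≤ (-X) ω} := by
      intro ω hω
      simpa only [Set.mem_union, Set.mem_ofPred_eq, Pi.neg_apply] using le_abs.1 hω
    have hpos := hX.measure_ge_le ht
    have hneg := hX.neg.measure_ge_le ht
    refine (measureReal_mono hsub).trans ((measureReal_union_le _ _).trans ?_)
    rw [show -(1 / (2 * (c : ℝ))) * t ^ 2 = -t ^ 2 / (2 * c) by ring]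
    linarith
  convert HasExpSqMoment.of_tail hX.aemeasurable zero_le_two (by positivity) htail using 1
  · field_simp
    norm_num
  · norm_num

namespace HasExpSqMoment

lemma integral_exp_mul_sq_le (h : HasExpSqMoment X l K μ) {m : ℝ} (hl : 0 < l) (hm : 0 ≤ m)
    (hml : m ≤ l) : ∫ ω, Real.exp (m * X ω ^ 2) ∂μ ≤ Real.exp (m * ((K - 1) / l)) :=
  calc ∫ ω, Real.exp (m * X ω ^ 2) ∂μ
      ≤ ∫ ω, ((1 - m / l) + m / l * Real.exp (l * X ω ^ 2)) ∂μ :=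
        integral_mono (h.integrable_exp_mul_sq_of_le hml)
          ((integrable_const _).add (h.integrable.const_mul _))
          fun ω => exp_mul_le_of_le hl hm hml _
    _ = (1 - m / l) + m / l * ∫ ω, Real.exp (l * X ω ^ 2) ∂μ := by
        rw [integral_add (integrable_const _) (h.integrable.const_mul _), integral_const_mul]
        simp
    _ ≤ (1 - m / l) + m / l * K := by
        gcongr
        exact h.integral_le
    _ = m * ((K - 1) / l) + 1 := by field_simp; ring
    _ ≤ Real.exp (m * ((K - 1) / l)) := Real.add_one_le_exp _

lemma integral_exp_neg_mul_sq_le (h : HasExpSqMoment X l K μ) {t : ℝ} (hl : 0 < l) (hK : 0 < K)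
    (ht : 0 ≤ t) (htl : t ≤ l ^ 2 / (2 * K)) (hvar : ∫ ω, X ω ^ 2 ∂μ = 1) :
    ∫ ω, Real.exp (-t * X ω ^ 2) ∂μ ≤ Real.exp (-t / 2) := by
  have hsq : Integrable (fun ω => 1 - t * X ω ^ 2) μ :=
    (integrable_const _).sub ((h.memLp_two hl).integrable_sq.const_mul t)
  have hpointwise : ∀ y : ℝ, 0 ≤ y →
      Real.exp (-t * y) ≤ 1 - t * y + t ^ 2 / l ^ 2 * Real.exp (l * y) := by
    intro y hy
    calc Real.exp (-t * y) ≤ 1 - t * y + (t * y) ^ 2 / 2 := by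
          rw [neg_mul]
          exact exp_neg_le_one_sub_add_sq (by positivity)
      _ = 1 - t * y + t ^ 2 / l ^ 2 * ((l * y) ^ 2 / 2) := by field_simp
      _ ≤ 1 - t * y + t ^ 2 / l ^ 2 * Real.exp (l * y) := by
          have : 0 ≤ l * y := by positivity
          gcongr
          linarith [Real.quadratic_le_exp_of_nonneg this]
  calc ∫ ω, Real.exp (-t * X ω ^ 2) ∂μ
      ≤ ∫ ω, (1 - t * X ω ^ 2 + t ^ 2 / l ^ 2 * Real.exp (l * X ω ^ 2)) ∂μ :=
        integral_mono (h.integrable_exp_mul_sq_of_le (by linarith))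
          (hsq.add (h.integrable.const_mul _)) fun ω => hpointwise _ (sq_nonneg _)
    _ = 1 - t + t ^ 2 / l ^ 2 * ∫ ω, Real.exp (l * X ω ^ 2) ∂μ := by
        rw [integral_add hsq (h.integrable.const_mul _), integral_sub (integrable_const _)
          ((h.memLp_two hl).integrable_sq.const_mul t)]
        simp [integral_const_mul, hvar]
    _ ≤ 1 - t + t ^ 2 / l ^ 2 * K := by
        gcongr
        exact h.integral_le
    _ ≤ -t / 2 + 1 := by
        have : t ^ 2 / l ^ 2 * K ≤ t / 2 := by
          rw [le_div_iff₀ (by positivity)] at htl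
          rw [div_mul_eq_mul_div, div_le_iff₀ (by positivity)]
          nlinarith
        linarith
    _ ≤ Real.exp (-t / 2) := Real.add_one_le_exp _

lemma mgf_le_of_sq_le (h : HasExpSqMoment X l K μ) (hl : 0 < l) (hX0 : ∫ ω, X ω ∂μ = 0) {t : ℝ}
    (ht : t ^ 2 ≤ l) : mgf X μ t ≤ Real.exp (t ^ 2 * ((K - 1) / l)) := by
  have hint := ((h.memLp_two hl).integrable one_le_two).const_mul t
  have hint_sq := h.integrable_exp_mul_sq_of_le ht
  calc mgf X μ t ≤ ∫ ω, (t * X ω + Real.exp (t ^ 2 * X ω ^ 2)) ∂μ := by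
        refine integral_mono (h.integrable_exp_mul hl t) (hint.add hint_sq) fun ω => ?_
        simpa only [mul_pow] using exp_le_add_exp_sq (t * X ω)
    _ = ∫ ω, Real.exp (t ^ 2 * X ω ^ 2) ∂μ := by
        rw [integral_add hint hint_sq, integral_const_mul, hX0, mul_zero, zero_add]
    _ ≤ Real.exp (t ^ 2 * ((K - 1) / l)) := h.integral_exp_mul_sq_le hl (sq_nonneg t) ht

lemma hasSubgaussianMGF (h : HasExpSqMoment X l K μ) (hl : 0 < l) (hK : 1 ≤ K)
    (hX0 : ∫ ω, X ω ∂μ = 0) : HasSubgaussianMGF X (2 * K / l).toNNReal μ := by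
  refine ⟨h.integrable_exp_mul hl, fun t => ?_⟩
  rw [Real.coe_toNNReal _ (by positivity),
    show 2 * K / l * t ^ 2 / 2 = t ^ 2 * (K / l) by ring]
  rcases le_total (t ^ 2) l with ht | ht
  · refine (h.mgf_le_of_sq_le hl hX0 ht).trans (Real.exp_le_exp.2 ?_)
    gcongr
    linarith
  · refine (h.mgf_le hl t).trans (Real.exp_le_exp.2 ?_)
    have hratio : 1 ≤ t ^ 2 / l := (one_le_div hl).2 ht
    calc t ^ 2 / (4 * l) + (K - 1) = t ^ 2 / l / 4 + (K - 1) := by field_simp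
      _ ≤ t ^ 2 / l * K := by nlinarith
      _ = t ^ 2 * (K / l) := by ring

end HasExpSqMoment

end ExponentialMoments

section Energy

variable {ι κ : Type*} [Fintype ι] [Fintype κ]

/-- The squared Euclidean norm as a quadratic form; the norm of `κ → ℝ` itself is the sup norm. -/
def l2NormSq : QuadraticForm ℝ (κ → ℝ) :=
  QuadraticMap.weightedSumSquares ℝ fun _ => (1 : ℝ)

/-- The quadratic form `z ↦ ‖A z‖₂²` of a matrix `A`. -/
def energy (A : Matrix ι κ ℝ) : QuadraticForm ℝ (κ → ℝ) :=
  l2NormSq.comp A.mulVecLin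

lemma l2NormSq_apply (z : κ → ℝ) : l2NormSq z = ∑ j, z j ^ 2 := by
  simp [l2NormSq, QuadraticMap.weightedSumSquares_apply, sq]

lemma energy_apply (A : Matrix ι κ ℝ) (z : κ → ℝ) : energy A z = ∑ i, (A.mulVec z) i ^ 2 :=
  l2NormSq_apply _

lemma exists_smul_unit {z : κ → ℝ} (hz : z ≠ 0) :
    ∃ (ρ : ℝ) (u : κ → ℝ), 0 < ρ ∧ ∑ j, u j ^ 2 = 1 ∧ z = ρ • u := by
  have hpos : 0 < ∑ j, z j ^ 2 := by
    obtain ⟨j, hj⟩ := Function.ne_iff.1 hz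
    exact Finset.sum_pos' (fun j _ => sq_nonneg _) ⟨j, Finset.mem_univ _, sq_pos_of_ne_zero hj⟩
  refine ⟨√(∑ j, z j ^ 2), (√(∑ j, z j ^ 2))⁻¹ • z, Real.sqrt_pos.2 hpos, ?_, ?_⟩
  · simp only [Pi.smul_apply, smul_eq_mul, mul_pow, ← Finset.mul_sum, inv_pow,
      Real.sq_sqrt hpos.le, inv_mul_cancel₀ hpos.ne']
  · rw [smul_inv_smul₀ (Real.sqrt_pos.2 hpos).ne']

end Energy

section Independence

variable {Ω ι κ : Type*} [MeasurableSpace Ω] {P : Measure Ω}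

lemma iIndepFun_curry {𝓧 : Type*} [MeasurableSpace 𝓧] {X : ι → κ → Ω → 𝓧}
    (mX : ∀ i j, Measurable (X i j)) (h : iIndepFun (fun (p : ι × κ) ω => X p.1 p.2 ω) P) :
    iIndepFun (fun i ω => (X i · ω)) P := by
  have := h.isProbabilityMeasure
  have : ∀ i j, IsProbabilityMeasure (P.map (X i j)) :=
    fun i j => Measure.isProbabilityMeasure_map (mX i j).aemeasurable
  have hrow : ∀ i, iIndepFun (X i) P := fun i =>
    h.precomp (g := Prod.mk i) (Prod.mk_right_injective i)
  have hcurry : MeasurableEquiv.curry ι κ 𝓧 ∘ (fun ω p => X p.1 p.2 ω) = fun ω i j => X i j ω := rfl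
  rw [iIndepFun_iff_map_fun_eq_infinitePi_map (by fun_prop), ← hcurry,
    ← Measure.map_map (by fun_prop) (by fun_prop),
    (iIndepFun_iff_map_fun_eq_infinitePi_map (by fun_prop)).1 h,
    Measure.infinitePi_map_curry (fun i j => P.map (X i j))]
  congrm Measure.infinitePi fun i => ?_
  rw [(iIndepFun_iff_map_fun_eq_infinitePi_map (by fun_prop)).1 (hrow i)]

lemma iIndepFun_row_sum [Fintype κ] {X : ι → κ → Ω → ℝ} (mX : ∀ i j, AEMeasurable (X i j) P)
    (h : iIndepFun (fun (p : ι × κ) ω => X p.1 p.2 ω) P) (z : κ → ℝ) :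
    iIndepFun (fun i ω => ∑ j, X i j ω * z j) P := by
  have hmk : iIndepFun (fun (p : ι × κ) ω => (mX p.1 p.2).mk _ ω) P :=
    h.congr fun p => (mX p.1 p.2).ae_eq_mk
  have hrows := iIndepFun_curry (X := fun i j => (mX i j).mk _)
    (fun i j => (mX i j).measurable_mk) hmk
  refine (hrows.comp (fun _ y => ∑ j, y j * z j) (fun _ => by fun_prop)).congr fun i => ?_
  filter_upwards [ae_all_iff.2 fun j => (mX i j).ae_eq_mk] with ω hω
  simp [hω]

end Independence

section Chernoff

variable {Ω ι : Type*} [MeasurableSpace Ω] {μ : Measure Ω} {s : Finset ι}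

lemma measureReal_le_sum_le_of_integral_exp_le {Y : ι → Ω → ℝ} (hind : iIndepFun Y μ)
    (hm : ∀ i, AEMeasurable (Y i) μ) (hint : ∀ i ∈ s, Integrable (fun ω => Real.exp (Y i ω)) μ)
    {a : ι → ℝ} (ha : ∀ i ∈ s, ∫ ω, Real.exp (Y i ω) ∂μ ≤ Real.exp (a i)) (τ : ℝ) :
    μ.real {ω | τ ≤ ∑ i ∈ s, Y i ω} ≤ Real.exp (∑ i ∈ s, a i - τ) := by
  have := hind.isProbabilityMeasure
  have hprod := hind.mgf_sum₀ (t := 1) hm s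
  have hintsum : Integrable (fun ω => Real.exp (1 * (∑ i ∈ s, Y i) ω)) μ := by
    apply Integrable.of_integral_ne_zero
    change mgf (∑ i ∈ s, Y i) μ 1 ≠ 0
    rw [hprod]
    exact (Finset.prod_pos fun i hi => mgf_pos (by simpa only [one_mul] using hint i hi)).ne'
  calc μ.real {ω | τ ≤ ∑ i ∈ s, Y i ω} = μ.real {ω | τ ≤ (∑ i ∈ s, Y i) ω} := by
        simp only [Finset.sum_apply]
    _ ≤ Real.exp (-1 * τ) * mgf (∑ i ∈ s, Y i) μ 1 :=
        measure_ge_le_exp_mul_mgf τ zero_le_one hintsum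
    _ ≤ Real.exp (-1 * τ) * ∏ i ∈ s, Real.exp (a i) := by
        rw [hprod]
        gcongr with i hi
        · exact fun i _ => mgf_nonneg
        · simpa only [mgf, one_mul] using ha i hi
    _ = Real.exp (∑ i ∈ s, a i - τ) := by
        rw [← Real.exp_sum, ← Real.exp_add]
        congr 1
        ring

variable {X : ι → Ω → ℝ} {l K : ℝ} {w : ι → ℝ}

lemma measureReal_le_sum_mul_sq_le (hX : ∀ i, HasExpSqMoment (X i) l K μ) (hind : iIndepFun X μ)
    (hl : 0 < l) (hw : ∀ i ∈ s, 0 ≤ w i) (hwl : ∀ i ∈ s, w i ≤ l) (τ : ℝ) :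
    μ.real {ω | τ ≤ ∑ i ∈ s, w i * X i ω ^ 2} ≤
      Real.exp ((K - 1) / l * ∑ i ∈ s, w i - τ) := by
  have := hind.isProbabilityMeasure
  have := fun i => (hX i).aemeasurable
  rw [mul_comm, Finset.sum_mul]
  exact measureReal_le_sum_le_of_integral_exp_le
    (hind.comp (fun i x => w i * x ^ 2) fun i => by fun_prop) (fun i => by fun_prop)
    (fun i hi => (hX i).integrable_exp_mul_sq_of_le (hwl i hi))
    (fun i hi => (hX i).integral_exp_mul_sq_le hl (hw i hi) (hwl i hi)) τ

lemma measureReal_sum_mul_sq_le_le (hX : ∀ i, HasExpSqMoment (X i) l K μ) (hind : iIndepFun X μ)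
    (hvar : ∀ i, ∫ ω, X i ω ^ 2 ∂μ = 1) (hl : 0 < l) (hK : 0 < K) (hw : ∀ i ∈ s, 0 ≤ w i)
    (hwl : ∀ i ∈ s, w i ≤ l ^ 2 / (2 * K)) (τ : ℝ) :
    μ.real {ω | ∑ i ∈ s, w i * X i ω ^ 2 ≤ τ} ≤ Real.exp (τ - (∑ i ∈ s, w i) / 2) := by
  have := hind.isProbabilityMeasure
  have := fun i => (hX i).aemeasurable
  have hneg := measureReal_le_sum_le_of_integral_exp_le (s := s)
    (hind.comp (fun i x => -w i * x ^ 2) fun i => by fun_prop) (fun i => by fun_prop)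
    (fun i hi => (hX i).integrable_exp_mul_sq_of_le (by linarith [hw i hi]))
    (fun i hi => (hX i).integral_exp_neg_mul_sq_le hl hK (hw i hi) (hwl i hi) (hvar i)) (-τ)
  convert! hneg using 2
  · ext ω
    simp [Finset.sum_neg_distrib]
  · rw [← Finset.sum_div, Finset.sum_neg_distrib]
    ring

end Chernoff

section SubGaussianArray

/-- An array of independent, centred, unit-variance random variables which are sub-Gaussian with
the common variance proxy `c`. -/
structure IsSubGaussianArray {Ω ι κ : Type*} [MeasurableSpace Ω] (c : NNReal) (μ : Measure Ω)
    (a : ι → κ → Ω → ℝ) : Prop where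
  indep : iIndepFun (fun (p : ι × κ) ω => a p.1 p.2 ω) μ
  subgaussian : ∀ i j, HasSubgaussianMGF (a i j) c μ
  mean_zero : ∀ i j, ∫ ω, a i j ω ∂μ = 0
  variance_one : ∀ i j, ∫ ω, a i j ω ^ 2 ∂μ = 1

namespace IsSubGaussianArray

variable {Ω ι κ : Type*} [MeasurableSpace Ω] [Fintype κ] {c : NNReal} {μ : Measure Ω}
  {a : ι → κ → Ω → ℝ} {u : κ → ℝ}

lemma hasSubgaussianMGF_row (h : IsSubGaussianArray c μ a) (hu : ∑ j, u j ^ 2 = 1) (i : ι) :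
    HasSubgaussianMGF (fun ω => ∑ j, a i j ω * u j) c μ := by
  have hrow : iIndepFun (a i) μ := h.indep.precomp (g := Prod.mk i) (Prod.mk_right_injective i)
  have hsum := HasSubgaussianMGF.sum_of_iIndepFun (s := Finset.univ)
    (hrow.comp (fun j x => u j * x) fun j => by fun_prop)
    (fun j _ => (h.subgaussian i j).const_mul (u j))
  convert! hsum using 1
  · ext ω
    simp [mul_comm]
  · apply NNReal.eq
    rw [NNReal.coe_sum]
    calc (c : ℝ) = (∑ j, u j ^ 2) * c := by rw [hu, one_mul]
      _ = _ := Finset.sum_mul _ _ _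

lemma integral_row_sq (h : IsSubGaussianArray c μ a) (hu : ∑ j, u j ^ 2 = 1) (i : ι) :
    ∫ ω, (∑ j, a i j ω * u j) ^ 2 ∂μ = 1 := by
  have := h.indep.isProbabilityMeasure
  have hrow : iIndepFun (a i) μ := h.indep.precomp (g := Prod.mk i) (Prod.mk_right_injective i)
  have hLp : ∀ j, MemLp (fun ω => a i j ω * u j) 2 μ := fun j =>
    MemLp.mul_const (by exact_mod_cast (h.subgaussian i j).memLp 2) (u j)
  have hvar : ∀ j, variance (fun ω => a i j ω * u j) μ = u j ^ 2 := fun j => by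
    rw [variance_of_integral_eq_zero (hLp j).aemeasurable
      (by rw [integral_mul_const, h.mean_zero, zero_mul])]
    simp only [mul_pow]
    rw [integral_mul_const, h.variance_one, one_mul]
  have hmean : ∫ ω, (∑ j, fun ω => a i j ω * u j) ω ∂μ = 0 := by
    simp only [Finset.sum_apply]
    rw [integral_finsetSum _ fun j _ => (hLp j).integrable one_le_two]
    simp only [integral_mul_const, h.mean_zero, zero_mul, Finset.sum_const_zero]
  have hvar_sum := IndepFun.variance_sum (s := Finset.univ) (fun j _ => hLp j)
    (fun j _ k _ hjk => (hrow.comp (fun j x => x * u j) fun j => by fun_prop).indepFun hjk)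
  rw [variance_of_integral_eq_zero
    (Finset.aemeasurable_sum _ fun j _ => (hLp j).aemeasurable) hmean] at hvar_sum
  simpa only [Finset.sum_apply, hvar, hu] using hvar_sum

variable {s : Finset ι} {w : ι → ℝ}

lemma hasExpSqMoment_row (h : IsSubGaussianArray c μ a) (hc : 0 < c) (hu : ∑ j, u j ^ 2 = 1)
    (i : ι) : HasExpSqMoment (fun ω => ∑ j, a i j ω * u j) (1 / (4 * c)) 3 μ :=
  have := h.indep.isProbabilityMeasure
  hasExpSqMoment_of_hasSubgaussianMGF hc (h.hasSubgaussianMGF_row hu i)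

lemma iIndepFun_row (h : IsSubGaussianArray c μ a) (u : κ → ℝ) :
    iIndepFun (fun i ω => ∑ j, a i j ω * u j) μ :=
  iIndepFun_row_sum (fun i j => (h.subgaussian i j).aemeasurable) h.indep u

lemma measureReal_le_sum_row_sq_le (h : IsSubGaussianArray c μ a) (hc : 0 < c)
    (hu : ∑ j, u j ^ 2 = 1) (hw : ∀ i ∈ s, 0 ≤ w i) (hwc : ∀ i ∈ s, w i ≤ 1 / (4 * c)) (τ : ℝ) :
    μ.real {ω | τ ≤ ∑ i ∈ s, w i * (∑ j, a i j ω * u j) ^ 2} ≤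
      Real.exp (8 * c * ∑ i ∈ s, w i - τ) := by
  have : (0 : ℝ) < c := hc
  convert measureReal_le_sum_mul_sq_le (h.hasExpSqMoment_row hc hu) (h.iIndepFun_row u)
    (by positivity) hw hwc τ using 4
  field_simp
  norm_num

lemma measureReal_sum_row_sq_le_le (h : IsSubGaussianArray c μ a) (hc : 0 < c)
    (hu : ∑ j, u j ^ 2 = 1) (hw : ∀ i ∈ s, 0 ≤ w i)
    (hwc : ∀ i ∈ s, w i ≤ (1 / (4 * c)) ^ 2 / 6) (τ : ℝ) :
    μ.real {ω | ∑ i ∈ s, w i * (∑ j, a i j ω * u j) ^ 2 ≤ τ} ≤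
      Real.exp (τ - (∑ i ∈ s, w i) / 2) := by
  have : (0 : ℝ) < c := hc
  refine measureReal_sum_mul_sq_le_le (h.hasExpSqMoment_row hc hu) (h.iIndepFun_row u)
    (h.integral_row_sq hu) (by positivity) three_pos hw (fun i hi => ?_) τ
  convert hwc i hi using 2
  norm_num

end IsSubGaussianArray

end SubGaussianArray

section BlockEnergy

/-- The rows of all the matrices `M v`, stacked into one array. -/
def stackedRows {V Ω : Type*} {N : V → ℕ} {d : ℕ} (M : ∀ v, Ω → Matrix (Fin (N v)) (Fin d) ℝ) :
    (Σ v, Fin (N v)) → Fin d → Ω → ℝ :=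
  fun p j ω => M p.1 ω p.2 j

/-- The exponential rate at which `energy (normalizedDesign M ω v) z` concentrates, for entries
with variance proxy `c`. -/
noncomputable def energyRate (c : NNReal) : ℝ :=
  min (1 / (4 * (c : ℝ))) ((1 / (4 * (c : ℝ))) ^ 2 / 6) / 4

/-- An upper bound for `energy (normalizedDesign M ω v) z / ‖z‖₂²` which holds with overwhelming
probability, for entries with variance proxy `c`. -/
noncomputable def energyBound (c : NNReal) : ℝ := 8 * c + 1

lemma energyRate_pos {c : NNReal} (hc : 0 < c) : 0 < energyRate c := by
  have : (0 : ℝ) < c := hc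
  unfold energyRate
  positivity

lemma one_le_energyBound (c : NNReal) : 1 ≤ energyBound c := by
  simp [energyBound]

variable {V Ω : Type*} {N : V → ℕ} {d : ℕ} {M : ∀ v, Ω → Matrix (Fin (N v)) (Fin d) ℝ}

lemma energy_normalizedDesign (ω : Ω) (v : V) (z : Fin d → ℝ) :
    energy (normalizedDesign M ω v) z = (∑ i, (∑ j, M v ω i j * z j) ^ 2) / N v := by
  simp only [energy_apply, normalizedDesign, Matrix.mulVec, dotProduct, Matrix.smul_apply,
    smul_eq_mul, mul_assoc, ← Finset.mul_sum, mul_pow, div_pow, one_pow,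
    Real.sq_sqrt (Nat.cast_nonneg (N v))]
  ring

lemma sum_mul_energy_normalizedDesign (s : Finset V) (t : ℝ) (ω : Ω) (z : Fin d → ℝ) :
    t * ∑ v ∈ s, energy (normalizedDesign M ω v) z =
      ∑ p ∈ s.sigma fun _ => Finset.univ, t / N p.1 * (∑ j, stackedRows M p j ω * z j) ^ 2 := by
  simp only [Finset.sum_sigma, ← Finset.mul_sum, energy_normalizedDesign, stackedRows]
  rw [Finset.mul_sum]
  exact Finset.sum_congr rfl fun v _ => by ring

lemma sum_sigma_div_card {s : Finset V} (hN : ∀ v ∈ s, 0 < N v) (t : ℝ) :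
    ∑ p ∈ s.sigma fun v => (Finset.univ : Finset (Fin (N v))), t / N p.1 = s.card * t := by
  have hblock : ∀ v ∈ s, ∑ _i : Fin (N v), t / (N v : ℝ) = t := fun v hv => by
    have : (N v : ℝ) ≠ 0 := by exact_mod_cast (hN v hv).ne'
    rw [Fin.sum_const, nsmul_eq_mul, mul_div_cancel₀ _ this]
  rw [Finset.sum_sigma, Finset.sum_congr rfl hblock, Finset.sum_const, nsmul_eq_mul]

variable [MeasurableSpace Ω] {μ : Measure Ω} {c : NNReal} {s : Finset V} {N₀ : ℝ}

lemma measureReal_quadraticForm_pos_le_of_unit [IsFiniteMeasure μ] {κ : Type*} [Fintype κ]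
    {Q : Ω → QuadraticForm ℝ (κ → ℝ)} {b : ℝ} (hb : 0 ≤ b)
    (hunit : ∀ u : κ → ℝ, ∑ j, u j ^ 2 = 1 → μ.real {ω | 0 ≤ Q ω u} ≤ b) (z : κ → ℝ) :
    μ.real {ω | 0 < Q ω z} ≤ b := by
  rcases eq_or_ne z 0 with rfl | hz
  · simpa using hb
  obtain ⟨ρ, u, hρ, hu, rfl⟩ := exists_smul_unit hz
  refine (measureReal_mono fun ω hω => ?_).trans (hunit u hu)
  simp only [Set.mem_ofPred_eq, QuadraticMap.map_smul, smul_eq_mul] at hω ⊢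
  exact (pos_of_mul_pos_right hω (by positivity)).le

namespace IsSubGaussianArray

lemma measureReal_sum_energy_le_le (h : IsSubGaussianArray c μ (stackedRows M)) (hc : 0 < c)
    (hN₀ : 0 < N₀) (hN : ∀ v ∈ s, N₀ ≤ N v) {u : Fin d → ℝ} (hu : ∑ j, u j ^ 2 = 1) :
    μ.real {ω | ∑ v ∈ s, energy (normalizedDesign M ω v) u ≤ s.card / 4} ≤
      Real.exp (-(energyRate c * s.card * N₀)) := by
  have hγ := energyRate_pos hc
  set t := 4 * energyRate c * N₀ with ht
  have ht0 : 0 < t := by positivity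
  have hNpos : ∀ v ∈ s, (0 : ℝ) < N v := fun v hv => hN₀.trans_le (hN v hv)
  have hweight : ∀ v ∈ s, t / N v ≤ (1 / (4 * c)) ^ 2 / 6 := fun v hv => by
    rw [div_le_iff₀ (hNpos v hv), ht]
    gcongr
    · rw [energyRate, mul_div_cancel₀ _ four_ne_zero]
      exact min_le_right _ _
    · exact hN v hv
  have htail := h.measureReal_sum_row_sq_le_le (s := s.sigma fun _ => Finset.univ)
    (w := fun p => t / N p.1) hc hu (fun p _ => by positivity)
    (fun p hp => hweight p.1 (Finset.mem_sigma.1 hp).1) (t * (s.card / 4))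
  simp only [← sum_mul_energy_normalizedDesign, mul_le_mul_iff_right₀ ht0] at htail
  rw [sum_sigma_div_card fun v hv => by exact_mod_cast hNpos v hv] at htail
  convert htail using 2
  rw [ht]
  ring

lemma measureReal_le_sum_energy_le (h : IsSubGaussianArray c μ (stackedRows M)) (hc : 0 < c)
    (hN₀ : 0 < N₀) (hN : ∀ v ∈ s, N₀ ≤ N v) {u : Fin d → ℝ} (hu : ∑ j, u j ^ 2 = 1) :
    μ.real {ω | energyBound c * s.card ≤ ∑ v ∈ s, energy (normalizedDesign M ω v) u} ≤
      Real.exp (-(energyRate c * s.card * N₀)) := by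
  have hγ := energyRate_pos hc
  set t := 4 * energyRate c * N₀ with ht
  have ht0 : 0 < t := by positivity
  have hNpos : ∀ v ∈ s, (0 : ℝ) < N v := fun v hv => hN₀.trans_le (hN v hv)
  have hweight : ∀ v ∈ s, t / N v ≤ 1 / (4 * c) := fun v hv => by
    rw [div_le_iff₀ (hNpos v hv), ht]
    gcongr
    · rw [energyRate, mul_div_cancel₀ _ four_ne_zero]
      exact min_le_left _ _
    · exact hN v hv
  have htail := h.measureReal_le_sum_row_sq_le (s := s.sigma fun _ => Finset.univ)
    (w := fun p => t / N p.1) hc hu (fun p _ => by positivity)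
    (fun p hp => hweight p.1 (Finset.mem_sigma.1 hp).1) (t * (energyBound c * s.card))
  simp only [← sum_mul_energy_normalizedDesign, mul_le_mul_iff_right₀ ht0] at htail
  rw [sum_sigma_div_card fun v hv => by exact_mod_cast hNpos v hv] at htail
  refine htail.trans (Real.exp_le_exp.2 ?_)
  have : 0 ≤ energyRate c * s.card * N₀ := by positivity
  rw [energyBound, ht]
  linarith

lemma measureReal_sum_energy_lt_le (h : IsSubGaussianArray c μ (stackedRows M)) (hc : 0 < c)
    (hN : ∀ v ∈ s, N₀ ≤ N v) (z : Fin d → ℝ) :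
    μ.real {ω | ∑ v ∈ s, energy (normalizedDesign M ω v) z < s.card / 4 * l2NormSq z} ≤
      Real.exp (-(energyRate c * s.card * N₀)) := by
  have := h.indep.isProbabilityMeasure
  have hγ := energyRate_pos hc
  rcases le_or_gt N₀ 0 with hN₀ | hN₀
  · have : energyRate c * s.card * N₀ ≤ 0 := mul_nonpos_of_nonneg_of_nonpos (by positivity) hN₀
    exact measureReal_le_one.trans (Real.one_le_exp (by linarith))
  have hhom := measureReal_quadraticForm_pos_le_of_unit (μ := μ) (Real.exp_pos _).le
    (Q := fun ω => (s.card / 4 : ℝ) • l2NormSq - ∑ v ∈ s, energy (normalizedDesign M ω v))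
    (fun u hu => by simpa [l2NormSq_apply, hu] using h.measureReal_sum_energy_le_le hc hN₀ hN hu)
  simpa using hhom z

lemma measureReal_lt_sum_energy_le (h : IsSubGaussianArray c μ (stackedRows M)) (hc : 0 < c)
    (hN : ∀ v ∈ s, N₀ ≤ N v) (z : Fin d → ℝ) :
    μ.real {ω | energyBound c * s.card * l2NormSq z <
      ∑ v ∈ s, energy (normalizedDesign M ω v) z} ≤
      Real.exp (-(energyRate c * s.card * N₀)) := by
  have := h.indep.isProbabilityMeasure
  have hγ := energyRate_pos hc
  rcases le_or_gt N₀ 0 with hN₀ | hN₀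
  · have : energyRate c * s.card * N₀ ≤ 0 := mul_nonpos_of_nonneg_of_nonpos (by positivity) hN₀
    exact measureReal_le_one.trans (Real.one_le_exp (by linarith))
  have hhom := measureReal_quadraticForm_pos_le_of_unit (μ := μ) (Real.exp_pos _).le
    (Q := fun ω => ∑ v ∈ s, energy (normalizedDesign M ω v) - (energyBound c * s.card) • l2NormSq)
    (fun u hu => by simpa [l2NormSq_apply, hu] using h.measureReal_le_sum_energy_le hc hN₀ hN hu)
  simpa using hhom z

end IsSubGaussianArray

end BlockEnergy

section Maurey

variable {E ι : Type*} [AddCommGroup E] [Module ℝ E] [Fintype ι] {p : ι → ℝ}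

lemma sum_mul_quadraticForm_add (Q : QuadraticForm ℝ E) (hp : ∑ i, p i = 1) (Y : ι → E) (b : E) :
    ∑ i, p i * Q (b + Y i) = Q (b + ∑ i, p i • Y i) +
      (∑ i, p i * Q (Y i) - Q (∑ i, p i • Y i)) := by
  have hadd : ∀ y, Q (b + y) = Q b + Q y + Q.polarBilin b y := QuadraticMap.map_add Q b
  simp only [hadd, map_sum, map_smul, smul_eq_mul, mul_add, Finset.sum_add_distrib,
    ← Finset.sum_mul, hp]
  ring

lemma quadraticForm_add_smul_nonneg_of_sum {Q : QuadraticForm ℝ E} {Y : ι → E}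
    (hp₀ : ∀ i, 0 ≤ p i) (hp : ∑ i, p i = 1) {m : ℕ} {b : E}
    (hQ : ∀ f : Fin m → ι, 0 ≤ Q (b + ∑ t, Y (f t))) :
    0 ≤ Q (b + (m : ℝ) • ∑ i, p i • Y i) +
      m * (∑ i, p i * Q (Y i) - Q (∑ i, p i • Y i)) := by
  set h := ∑ i, p i • Y i with hh
  set D := ∑ i, p i * Q (Y i) - Q h with hD
  induction m generalizing b with
  | zero => simpa using hQ Fin.elim0
  | succ m ih =>
    have hstep : ∀ i, 0 ≤ Q (b + (m : ℝ) • h + Y i) + m * D := fun i => by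
      have := ih (b := b + Y i) fun f => by
        simpa [Fin.sum_univ_succ, add_assoc] using hQ (Fin.cons i f)
      rwa [add_right_comm] at this
    calc (0 : ℝ) ≤ ∑ i, p i * (Q (b + (m : ℝ) • h + Y i) + m * D) :=
          Finset.sum_nonneg fun i _ => mul_nonneg (hp₀ i) (hstep i)
      _ = Q (b + (m : ℝ) • h + h) + D + m * D := by
          simp only [mul_add, Finset.sum_add_distrib, ← Finset.sum_mul, hp, one_mul, hh, hD,
            sum_mul_quadraticForm_add Q hp]
      _ = Q (b + ((m + 1 : ℕ) : ℝ) • h) + ((m + 1 : ℕ) : ℝ) * D := by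
          rw [Nat.cast_succ, add_smul, one_smul, ← add_assoc]
          ring

/-- The signed basis vector `±eⱼ` encoded by `x = (j, ±1)`. -/
def signedBasis {d : ℕ} (x : Fin d × ℤˣ) : Fin d → ℝ :=
  Pi.single x.1 ((x.2 : ℤ) : ℝ)

/-- The sum of the signed basis vectors listed by `f`; Maurey's empirical method reduces bounds on
all vectors to bounds on these finitely many. -/
def signedSum {d k : ℕ} (f : Fin k → Fin d × ℤˣ) : Fin d → ℝ :=
  ∑ t, signedBasis (f t)

variable {d : ℕ}

lemma l1Norm_nonneg (u : Fin d → ℝ) : 0 ≤ l1Norm u := Finset.sum_nonneg fun _ _ => abs_nonneg _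

lemma eq_zero_of_l1Norm_eq_zero {u : Fin d → ℝ} (h : l1Norm u = 0) : u = 0 := by
  ext j
  simpa using (Finset.sum_eq_zero_iff_of_nonneg fun j _ => abs_nonneg (u j)).1 h j
    (Finset.mem_univ _)

lemma quadraticForm_signedBasis (Q : QuadraticForm ℝ (Fin d → ℝ)) (x : Fin d × ℤˣ) :
    Q (signedBasis x) = Q (Pi.single x.1 1) := by
  rcases Int.units_eq_one_or x.2 with h | h <;> simp [signedBasis, h, Pi.single_neg]

lemma exists_eq_sum_smul_signedBasis (h : Fin d → ℝ) :
    ∃ σ : Fin d → ℤˣ, h = ∑ j, |h j| • signedBasis (j, σ j) := by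
  refine ⟨fun j => if 0 ≤ h j then 1 else -1, ?_⟩
  ext i
  rw [Finset.sum_apply, Finset.sum_eq_single i (fun j _ hj => by simp [signedBasis, hj.symm])
    (by simp)]
  by_cases hi : 0 ≤ h i
  · simp [signedBasis, hi, abs_of_nonneg hi]
  · simp [signedBasis, hi, abs_of_neg (not_le.1 hi)]

lemma nonneg_add_mul_l1Norm_sq_of_signedSum {Q : QuadraticForm ℝ (Fin d → ℝ)} {k : ℕ} {B : ℝ}
    (hQ : ∀ f : Fin (k + 1) → Fin d × ℤˣ, 0 ≤ Q (signedSum f))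
    (hB : ∀ j, Q (Pi.single j 1) ≤ B) (h : Fin d → ℝ) :
    0 ≤ k * Q h + B * l1Norm h ^ 2 := by
  rcases (l1Norm_nonneg h).eq_or_lt' with hT | hT
  · simp [eq_zero_of_l1Norm_eq_zero hT, l1Norm]
  obtain ⟨σ, hσ⟩ := exists_eq_sum_smul_signedBasis h
  set T := l1Norm h
  have hp : ∑ j, |h j| / T = 1 := by rw [← Finset.sum_div]; exact div_self hT.ne'
  have hp₀ : ∀ j, 0 ≤ |h j| / T := fun j => by positivity
  have hmean : ∑ j, (|h j| / T) • T • signedBasis (j, σ j) = h := by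
    simp only [smul_smul, div_mul_cancel₀ _ hT.ne']
    exact hσ.symm
  have hvar : ∑ j, |h j| / T * Q (T • signedBasis (j, σ j)) ≤ B * T ^ 2 :=
    calc _ ≤ ∑ j, |h j| / T * (B * T ^ 2) := by
          gcongr with j
          rw [QuadraticMap.map_smul, quadraticForm_signedBasis, smul_eq_mul, ← sq, mul_comm]
          gcongr
          exact hB j
      _ = B * T ^ 2 := by rw [← Finset.sum_mul, hp, one_mul]
  have hmaurey := quadraticForm_add_smul_nonneg_of_sum (m := k + 1) (b := 0) hp₀ hp
    (Q := Q) (Y := fun j => T • signedBasis (j, σ j)) fun f => by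
      rw [zero_add, ← Finset.smul_sum, QuadraticMap.map_smul, smul_eq_mul]
      exact mul_nonneg (mul_self_nonneg T) (hQ fun t => (f t, σ (f t)))
  rw [hmean, zero_add, QuadraticMap.map_smul, smul_eq_mul] at hmaurey
  push_cast at hmaurey
  have : 0 ≤ (k + 1 : ℝ) * (k * Q h + ∑ j, |h j| / T * Q (T • signedBasis (j, σ j))) := by
    linarith
  linarith [nonneg_of_mul_nonneg_right this (by positivity)]

end Maurey

section Cone

variable {d : ℕ}

open Classical in
/-- The `ℓ¹` mass of `u` on the support of `y`. -/
noncomputable def l1On (y u : Fin d → ℝ) : ℝ := ∑ j with y j ≠ 0, |u j|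

lemma l1Norm_add_ge (y u : Fin d → ℝ) : l1Norm y + l1Norm u - 2 * l1On y u ≤ l1Norm (y + u) := by
  classical
  simp only [l1Norm, l1On, Finset.sum_filter, Finset.mul_sum, ← Finset.sum_add_distrib,
    ← Finset.sum_sub_distrib]
  refine Finset.sum_le_sum fun j _ => ?_
  by_cases hj : y j = 0
  · simp [hj]
  · have := abs_sub (y j + u j) (u j)
    rw [add_sub_cancel_right] at this
    simp only [ne_eq, hj, not_false_eq_true, if_true, Pi.add_apply]
    linarith

lemma l1On_sq_le (y u : Fin d → ℝ) : l1On y u ^ 2 ≤ (supp y).ncard * l2NormSq u := by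
  classical
  have hcard : (supp y).ncard = (Finset.univ.filter fun j => y j ≠ 0).card := by
    rw [← Set.ncard_coe_finset, Finset.coe_filter_univ, supp]
  rw [hcard, l2NormSq_apply]
  refine sq_sum_le_card_mul_sum_sq.trans ?_
  gcongr
  simp only [sq_abs]
  exact Finset.sum_le_sum_of_subset_of_nonneg (Finset.subset_univ _) fun _ _ _ => sq_nonneg _

end Cone

section Graph

variable {V : Type*} {d : ℕ}

lemma ncard_supp_add_le (y u : Fin d → ℝ) :
    (supp (y + u)).ncard ≤ (supp y).ncard + (supp u).ncard := by
  refine (Set.ncard_le_ncard ?_ (Set.toFinite _)).trans (Set.ncard_union_le _ _)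
  exact Function.support_add y u

lemma ncard_supp_sub_le_of_walk {G : SimpleGraph V} {s' : ℕ} {x : V → Fin d → ℝ}
    (hx : ∀ v w, G.Adj v w → (supp (x v - x w)).ncard ≤ s') {v w : V} (p : G.Walk v w) :
    (supp (x v - x w)).ncard ≤ p.length * s' := by
  induction p with
  | nil => simp [supp]
  | @cons u v w h p ih =>
    rw [← sub_add_sub_cancel (x u) (x v) (x w), SimpleGraph.Walk.length_cons, add_mul, one_mul,
      add_comm (p.length * s')]
    exact (ncard_supp_add_le _ _).trans (add_le_add (hx _ _ h) ih)

lemma IsGraphSparse.ncard_supp_sub_le [Finite V] {G : SimpleGraph V} {r : V} {s s' : ℕ}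
    {x : V → Fin d → ℝ} (hx : IsGraphSparse G r s s' x) (hG : G.Connected) (v w : V) :
    (supp (x v - x w)).ncard ≤ G.diam * s' := by
  have := hG.nonempty
  obtain ⟨p, hp⟩ := hG.exists_walk_length_eq_dist v w
  refine (ncard_supp_sub_le_of_walk hx.2 p).trans (Nat.mul_le_mul_right _ ?_)
  rw [hp]
  exact SimpleGraph.dist_le_diam (SimpleGraph.connected_iff_ediam_ne_top.1 hG)

variable [Fintype V]

lemma edgeFinset_starGraph [DecidableEq V] (r : V) [Fintype (SimpleGraph.starGraph r).edgeSet] :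
    (SimpleGraph.starGraph r).edgeFinset = (Finset.univ.erase r).image fun v => s(v, r) := by
  ext e
  induction e using Sym2.ind with
  | _ v w =>
    simp only [SimpleGraph.mem_edgeFinset, SimpleGraph.mem_edgeSet, SimpleGraph.starGraph_adj,
      Finset.mem_image, Finset.mem_erase, Finset.mem_univ, and_true, Sym2.eq_iff]
    constructor
    · rintro ⟨hne, rfl | rfl⟩
      · exact ⟨w, hne.symm, Or.inr ⟨rfl, rfl⟩⟩
      · exact ⟨v, hne, Or.inl ⟨rfl, rfl⟩⟩
    · rintro ⟨u, hu, ⟨rfl, rfl⟩ | ⟨rfl, rfl⟩⟩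
      · exact ⟨hu, Or.inr rfl⟩
      · exact ⟨hu.symm, Or.inl rfl⟩

open Classical in
lemma tvObjective_starGraph (r : V) (x : V → Fin d → ℝ) :
    tvObjective (SimpleGraph.starGraph r) r x =
      l1Norm (x r) + ∑ v ∈ Finset.univ.erase r, l1Norm (x v - x r) := by
  have hinj : Set.InjOn (fun v => s(v, r)) (Finset.univ.erase r : Finset V) :=
    fun v _ w _ hvw => Sym2.congr_left.1 hvw
  rw [tvObjective, edgeFinset_starGraph, Finset.sum_image hinj]
  rfl

open Classical in
lemma cone_of_tvObjective_starGraph_le {r : V} {x z : V → Fin d → ℝ}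
    (h : tvObjective (SimpleGraph.starGraph r) r z ≤ tvObjective (SimpleGraph.starGraph r) r x) :
    l1Norm (z r - x r) + ∑ v ∈ Finset.univ.erase r, l1Norm ((z v - x v) - (z r - x r)) ≤
      2 * (l1On (x r) (z r - x r) +
        ∑ v ∈ Finset.univ.erase r, l1On (x v - x r) ((z v - x v) - (z r - x r))) := by
  rw [tvObjective_starGraph, tvObjective_starGraph] at h
  have hroot := l1Norm_add_ge (x r) (z r - x r)
  rw [add_sub_cancel] at hroot
  have hnode : ∀ v, l1Norm (x v - x r) + l1Norm ((z v - x v) - (z r - x r)) -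
      2 * l1On (x v - x r) ((z v - x v) - (z r - x r)) ≤ l1Norm (z v - z r) := fun v => by
    have := l1Norm_add_ge (x v - x r) ((z v - x v) - (z r - x r))
    rwa [show x v - x r + (z v - x v - (z r - x r)) = z v - z r by abel] at this
  have hsum := Finset.sum_le_sum fun v (_ : v ∈ Finset.univ.erase r) => hnode v
  rw [Finset.sum_sub_distrib, Finset.sum_add_distrib, ← Finset.mul_sum] at hsum
  linarith

open Classical in
lemma eq_of_tvObjective_starGraph_le {r : V} {x z : V → Fin d → ℝ}
    (h : tvObjective (SimpleGraph.starGraph r) r z ≤ tvObjective (SimpleGraph.starGraph r) r x)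
    {g : V → ℝ} (hroot : l1On (x r) (z r - x r) ≤ 1 / 5 * l1Norm (z r - x r))
    (hnode : ∀ v ∈ Finset.univ.erase r, l1On (x v - x r) ((z v - x v) - (z r - x r)) ≤
      g v + 1 / 5 * l1Norm ((z v - x v) - (z r - x r)))
    (hg : ∑ v ∈ Finset.univ.erase r, g v ≤ 1 / 5 * l1Norm (z r - x r)) : z = x := by
  have hcone := cone_of_tvObjective_starGraph_le h
  have hsum := Finset.sum_le_sum hnode
  rw [Finset.sum_add_distrib, ← Finset.mul_sum] at hsum
  have hnonneg : ∀ v ∈ Finset.univ.erase r, 0 ≤ l1Norm ((z v - x v) - (z r - x r)) :=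
    fun v _ => l1Norm_nonneg _
  have hroot₀ := l1Norm_nonneg (z r - x r)
  have hsum₀ := Finset.sum_nonneg hnonneg
  have hr : z r - x r = 0 := eq_zero_of_l1Norm_eq_zero (by linarith)
  have hv := (Finset.sum_eq_zero_iff_of_nonneg hnonneg).1 (by linarith)
  ext1 v
  by_cases hvr : v = r
  · rw [hvr]
    exact sub_eq_zero.1 hr
  · have := eq_zero_of_l1Norm_eq_zero (hv v (by simp [hvr]))
    rw [hr, sub_zero] at this
    exact sub_eq_zero.1 this

end Graph

section RestrictedBounds

variable {d m k : ℕ} {B θ : ℝ} {Q : QuadraticForm ℝ (Fin d → ℝ)}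

/-- The restricted eigenvalue condition with sparsity level `m` and tolerance `θ`: up to the `ℓ¹`
term, `Q` is at least a quarter of the squared Euclidean norm. -/
def RestrictedLowerBound (Q : QuadraticForm ℝ (Fin d → ℝ)) (θ : ℝ) (m : ℕ) : Prop :=
  ∀ u, m * l2NormSq u ≤ 4 * m * Q u + θ * l1Norm u ^ 2

/-- The upper counterpart of `RestrictedLowerBound`: up to the `ℓ¹` term, `Q` is at most `B` times
the squared Euclidean norm. -/
def RestrictedUpperBound (Q : QuadraticForm ℝ (Fin d → ℝ)) (B θ : ℝ) (m : ℕ) : Prop :=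
  ∀ u, m * Q u ≤ B * (m * l2NormSq u + θ * l1Norm u ^ 2)

lemma l2NormSq_nonneg (u : Fin d → ℝ) : 0 ≤ l2NormSq u := by
  rw [l2NormSq_apply]
  positivity

lemma l2NormSq_single (j : Fin d) : l2NormSq (Pi.single j (1 : ℝ)) = 1 := by
  simp [l2NormSq_apply, Pi.single_apply]

lemma restrictedLowerBound_zero_right (hθ : 0 ≤ θ) : RestrictedLowerBound Q θ 0 := fun u => by
  simp only [Nat.cast_zero, zero_mul, mul_zero, zero_add]
  positivity

lemma restrictedUpperBound_zero_right (hB : 0 ≤ B) (hθ : 0 ≤ θ) : RestrictedUpperBound Q B θ 0 :=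
  fun u => by
    simp only [Nat.cast_zero, zero_mul, zero_add]
    positivity

lemma restrictedUpperBound_zero_left (hB : 0 ≤ B) (hθ : 0 ≤ θ) :
    RestrictedUpperBound (0 : QuadraticForm ℝ (Fin d → ℝ)) B θ m := fun u => by
  have := l2NormSq_nonneg u
  rw [zero_apply, mul_zero]
  positivity

lemma restrictedLowerBound_of_subsingleton [Subsingleton (Fin d)] (hθ : 0 ≤ θ)
    (hQ : l2NormSq (1 : Fin d → ℝ) / 4 ≤ Q 1) : RestrictedLowerBound Q θ m := fun u => by
  obtain ⟨a, rfl⟩ : ∃ a : ℝ, u = a • 1 :=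
    ⟨∑ j, u j, funext fun j => by simp [Fintype.sum_subsingleton u j]⟩
  set e : Fin d → ℝ := 1
  have hscaled : (m * (a * a)) * (l2NormSq e / 4) ≤ (m * (a * a)) * Q e := by
    have := mul_self_nonneg a
    gcongr
  have hl1 : 0 ≤ θ * l1Norm (a • e) ^ 2 := by positivity
  rw [QuadraticMap.map_smul, QuadraticMap.map_smul, smul_eq_mul, smul_eq_mul]
  linarith

lemma restrictedLowerBound_of_signedSum (hk : 0 < k) (hkθ : 4 * B ≤ k * θ)
    (hsum : ∀ f : Fin (k * m + 1) → Fin d × ℤˣ, l2NormSq (signedSum f) / 4 ≤ Q (signedSum f))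
    (hcol : ∀ j, Q (Pi.single j 1) ≤ B) : RestrictedLowerBound Q θ m := fun u => by
  have hform : ∀ w, (Q - (1 / 4 : ℝ) • l2NormSq : QuadraticForm ℝ _) w =
      Q w - l2NormSq w / 4 := fun w => by
    simp only [sub_apply, smul_apply, smul_eq_mul]
    ring
  have hmaurey := nonneg_add_mul_l1Norm_sq_of_signedSum (Q := Q - (1 / 4 : ℝ) • l2NormSq) (B := B)
    (fun f => by rw [hform]; exact sub_nonneg.2 (hsum f))
    (fun j => by rw [hform, l2NormSq_single]; linarith [hcol j]) u
  rw [hform] at hmaurey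
  push_cast at hmaurey
  have hk' : (0 : ℝ) < k := by exact_mod_cast hk
  have hθ := mul_le_mul_of_nonneg_right hkθ (sq_nonneg (l1Norm u))
  refine le_of_mul_le_mul_left ?_ hk'
  linarith

lemma restrictedUpperBound_of_signedSum (hk : 0 < k) (hkθ : 1 ≤ k * θ) (hB : 0 ≤ B)
    (hQ : ∀ u, 0 ≤ Q u)
    (hsum : ∀ f : Fin (k * m + 1) → Fin d × ℤˣ, Q (signedSum f) ≤ B * l2NormSq (signedSum f)) :
    RestrictedUpperBound Q B θ m := fun u => by
  have hform : ∀ w, (B • l2NormSq - Q : QuadraticForm ℝ _) w = B * l2NormSq w - Q w := fun w => rfl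
  have hmaurey := nonneg_add_mul_l1Norm_sq_of_signedSum (Q := B • l2NormSq - Q) (B := B)
    (fun f => by rw [hform]; exact sub_nonneg.2 (hsum f))
    (fun j => by rw [hform, l2NormSq_single]; linarith [hQ (Pi.single j 1)]) u
  rw [hform] at hmaurey
  push_cast at hmaurey
  have hk' : (0 : ℝ) < k := by exact_mod_cast hk
  have hθ := mul_le_mul_of_nonneg_right hkθ (mul_nonneg hB (sq_nonneg (l1Norm u)))
  refine le_of_mul_le_mul_left ?_ hk'
  linarith

lemma RestrictedLowerBound.l1On_le (h : RestrictedLowerBound Q θ m) (hθ : θ ≤ 1 / 25)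
    {y u : Fin d → ℝ} (hy : (supp y).ncard ≤ m) (hQ : 0 ≤ Q u) :
    l1On y u ≤ √(4 * m * Q u) + 1 / 5 * l1Norm u := by
  have hl1 := l1Norm_nonneg u
  have hsqrt := Real.sqrt_nonneg (4 * m * Q u)
  refine le_of_sq_le_sq ?_ (by positivity)
  calc l1On y u ^ 2 ≤ m * l2NormSq u := (l1On_sq_le y u).trans <| by
        gcongr
        exact l2NormSq_nonneg u
    _ ≤ 4 * m * Q u + θ * l1Norm u ^ 2 := h u
    _ ≤ √(4 * m * Q u) ^ 2 + 1 / 25 * l1Norm u ^ 2 := by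
        rw [Real.sq_sqrt (by positivity)]
        gcongr
    _ ≤ (√(4 * m * Q u) + 1 / 5 * l1Norm u) ^ 2 := by
        nlinarith [mul_nonneg hsqrt hl1]

end RestrictedBounds

section Recovery

variable {V : Type*} {d : ℕ}

lemma sum_sqrt_le {s : Finset V} {a : V → ℝ} {b : ℝ} (ha : ∀ v ∈ s, 0 ≤ a v) (hb : 0 ≤ b)
    (hab : s.card * ∑ v ∈ s, a v ≤ b ^ 2) : ∑ v ∈ s, √(a v) ≤ b := by
  refine le_of_sq_le_sq (sq_sum_le_card_mul_sum_sq.trans ?_) hb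
  rwa [Finset.sum_congr rfl fun v hv => Real.sq_sqrt (ha v hv)]

variable {N : V → ℕ} {A : ∀ v, Matrix (Fin (N v)) (Fin d) ℝ} {x z : V → Fin d → ℝ} {B θ : ℝ}
  {t m : ℕ} {r : V}

lemma energy_nonneg {ι : Type*} [Fintype ι] (A : Matrix ι (Fin d) ℝ) (u : Fin d → ℝ) :
    0 ≤ energy A u := by
  rw [energy_apply]
  positivity

lemma energy_sub_eq {ι : Type*} [Fintype ι] {A : Matrix ι (Fin d) ℝ} {y y' : Fin d → ℝ}
    (h : A.mulVec y = A.mulVec y') (u : Fin d → ℝ) : energy A (y - y' - u) = energy A u := by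
  simp [energy_apply, Matrix.mulVec_sub, h]

variable [Fintype V]

open Classical in
lemma sum_sqrt_energy_le {u : Fin d → ℝ} (hB : 0 ≤ B) (hBθ : 200 * B * θ ≤ 1)
    (hu : Fintype.card V ^ 2 * t * l2NormSq u ≤ θ * l1Norm u ^ 2)
    (hout : RestrictedUpperBound (∑ v ∈ Finset.univ.erase r, energy (A v))
      (B * (Finset.univ.erase r).card) θ (Fintype.card V ^ 2 * t)) :
    ∑ v ∈ Finset.univ.erase r, √(4 * t * energy (A v) u) ≤ 1 / 5 * l1Norm u := by
  have hE : ∀ v, 0 ≤ energy (A v) u := fun v => energy_nonneg _ _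
  have hl1 := l1Norm_nonneg u
  have hl2 := l2NormSq_nonneg u
  set S := ∑ v ∈ Finset.univ.erase r, energy (A v) u with hS
  set q := ((Finset.univ.erase r).card : ℝ)
  set n := Fintype.card V
  have hn : (0 : ℝ) < n := by exact_mod_cast Fintype.card_pos_iff.2 ⟨r⟩
  have hq : q ≤ n := Nat.cast_le.2 (Finset.card_le_univ _)
  have hout' : n ^ 2 * t * S ≤ B * q * (2 * (θ * l1Norm u ^ 2)) := by
    have := hout u
    rw [sum_apply] at this
    push_cast at this
    grw [this, hu]
    rw [two_mul]
  refine sum_sqrt_le (fun v _ => by have := hE v; positivity) (by positivity) ?_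
  rw [← Finset.mul_sum]
  refine le_of_mul_le_mul_left ?_ (pow_pos hn 2)
  calc n ^ 2 * (q * (4 * t * S)) = 4 * q * (n ^ 2 * t * S) := by ring
    _ ≤ 4 * q * (B * q * (2 * (θ * l1Norm u ^ 2))) := by gcongr
    _ = q ^ 2 * (8 * B * (θ * l1Norm u ^ 2)) := by ring
    _ ≤ n ^ 2 * (8 * B * (θ * l1Norm u ^ 2)) := by
        have : 0 ≤ θ * l1Norm u ^ 2 := le_trans (by positivity) hu
        gcongr
    _ ≤ n ^ 2 * (1 / 5 * l1Norm u) ^ 2 := by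
        gcongr
        linarith [mul_le_mul_of_nonneg_right hBθ (sq_nonneg (l1Norm u))]

open Classical in
lemma eq_of_restrictedBounds (hB : 1 ≤ B) (hBθ : 200 * B * θ ≤ 1)
    (hroot : RestrictedLowerBound (energy (A r)) θ m)
    (hnode : ∀ v, v ≠ r → RestrictedLowerBound (energy (A v)) θ t)
    (hout : RestrictedUpperBound (∑ v ∈ Finset.univ.erase r, energy (A v))
      (B * (Finset.univ.erase r).card) θ (Fintype.card V ^ 2 * t))
    (htm : Fintype.card V ^ 2 * t ≤ m) (hxr : (supp (x r)).ncard ≤ m)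
    (hx : ∀ v, (supp (x v - x r)).ncard ≤ t)
    (hz : ∀ v, (A v).mulVec (z v) = (A v).mulVec (x v))
    (hobj : tvObjective (SimpleGraph.starGraph r) r z ≤
      tvObjective (SimpleGraph.starGraph r) r x) : z = x := by
  have hθ : θ ≤ 1 / 25 := by
    by_contra! hθ
    nlinarith
  set h := z r - x r with hh
  have hEr : energy (A r) h = 0 := by simpa [hh] using energy_sub_eq (hz r) 0
  have hu : Fintype.card V ^ 2 * t * l2NormSq h ≤ θ * l1Norm h ^ 2 := by
    have htm' : (Fintype.card V ^ 2 * t : ℝ) ≤ m := by exact_mod_cast htm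
    grw [htm']
    · simpa [hEr] using hroot h
    · exact l2NormSq_nonneg h
  refine eq_of_tvObjective_starGraph_le (g := fun v => √(4 * t * energy (A v) h)) hobj ?_ ?_ ?_
  · simpa [hEr] using hroot.l1On_le hθ hxr (energy_nonneg _ h)
  · intro v hv
    rw [← energy_sub_eq (hz v) h]
    exact (hnode v (Finset.ne_of_mem_erase hv)).l1On_le hθ (hx v) (energy_nonneg _ _)
  · exact sum_sqrt_energy_le (by linarith) hBθ hu hout

lemma isTVBPSolution_iff_eq {H : SimpleGraph V}
    (huniq : ∀ z, (∀ v, (A v).mulVec (z v) = (A v).mulVec (x v)) →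
      tvObjective H r z ≤ tvObjective H r x → z = x) :
    IsTVBPSolution H r A (fun v => (A v).mulVec (x v)) z ↔ z = x := by
  have hx : IsTVBPFeasible A (fun v => (A v).mulVec (x v)) x := fun v => rfl
  constructor
  · rintro ⟨hz, hmin⟩
    exact huniq z hz (hmin x hx)
  · rintro rfl
    refine ⟨hx, fun y hy => ?_⟩
    by_contra! hlt
    rw [huniq y hy hlt.le] at hlt
    exact lt_irrefl _ hlt

end Recovery

section UnionBound

variable {d K m p q : ℕ} {c : NNReal} {η ε θ : ℝ}

/-- The number of signed basis vectors, per unit of sparsity, that Maurey's empirical method needs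
to reach the tolerance `θ` for entries with variance proxy `c`. -/
noncomputable def maureyLength (c : NNReal) (θ : ℝ) : ℕ :=
  ⌈4 * energyBound c / θ⌉₊

/-- The number of measurements, per unit of sparsity times logarithmic factor, which makes the
failure probability of a restricted bound with tolerance `θ` at most `2⁻ᵖ` times its target. -/
noncomputable def sampleFactor (c : NNReal) (θ : ℝ) (p : ℕ) : ℝ :=
  2 * (2 * maureyLength c θ + p + 4) / energyRate c

lemma maureyLength_pos (c : NNReal) (hθ : 0 < θ) : 0 < maureyLength c θ := by
  have := one_le_energyBound c
  exact Nat.ceil_pos.2 (by positivity)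

lemma le_maureyLength_mul (c : NNReal) (hθ : 0 < θ) :
    4 * energyBound c ≤ maureyLength c θ * θ :=
  (div_le_iff₀ hθ).1 (Nat.le_ceil _)

lemma sampleFactor_pos (hc : 0 < c) (θ : ℝ) (p : ℕ) : 0 < sampleFactor c θ p := by
  have := energyRate_pos hc
  unfold sampleFactor
  positivity

lemma two_mul_le_energyRate_mul (hc : 0 < c) {T X : ℝ} (h : sampleFactor c θ p * T ≤ X) :
    2 * ((2 * maureyLength c θ + p + 4) * T) ≤ energyRate c * X := by
  have hγ := energyRate_pos hc
  calc 2 * ((2 * maureyLength c θ + p + 4) * T) = energyRate c * (sampleFactor c θ p * T) := by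
        unfold sampleFactor
        field_simp
    _ ≤ energyRate c * X := by gcongr

lemma exp_neg_log_one_div (hη : 0 < η) : Real.exp (-Real.log (1 / η)) = η := by
  rw [one_div, Real.log_inv, neg_neg, Real.exp_log hη]

lemma two_mul_pow_add_le_exp {L : ℝ} (hL : Real.log 2 ≤ L) (hd : Real.log d ≤ L) (k : ℕ) :
    (2 * d : ℝ) ^ (k + 1) + d ≤ Real.exp ((2 * k + 3) * L) := by
  have hL0 : 0 ≤ L := (Real.log_nonneg one_le_two).trans hL
  have htwo : 2 ≤ Real.exp L := (Real.log_le_iff_le_exp two_pos).1 hL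
  have hdL : (d : ℝ) ≤ Real.exp L := (Real.le_exp_log _).trans (Real.exp_le_exp.2 hd)
  have hpow : (2 * d : ℝ) ^ (k + 1) ≤ Real.exp ((2 * k + 2) * L) := by
    calc (2 * d : ℝ) ^ (k + 1) ≤ (Real.exp L * Real.exp L) ^ (k + 1) := by gcongr
      _ = Real.exp ((2 * k + 2) * L) := by
        rw [← Real.exp_add, ← Real.exp_nat_mul]
        push_cast
        ring_nf
  have hone : (d : ℝ) ≤ Real.exp ((2 * k + 2) * L) :=
    hdL.trans <| Real.exp_le_exp.2 <| le_mul_of_one_le_left hL0 <| by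
      have : (0 : ℝ) ≤ k := k.cast_nonneg
      linarith
  calc (2 * d : ℝ) ^ (k + 1) + d ≤ 2 * Real.exp ((2 * k + 2) * L) := by linarith
    _ ≤ Real.exp L * Real.exp ((2 * k + 2) * L) := by gcongr
    _ = Real.exp ((2 * k + 3) * L) := by
      rw [← Real.exp_add]
      ring_nf

lemma two_mul_pow_add_mul_exp_le {X : ℝ} (hq : 0 < q) (hη : 0 < η) (hη1 : η ≤ 1)
    (hL : Real.log 2 ≤ Real.log d + Real.log (1 / η))
    (hX : (2 * K + p + 4) * (q * (Real.log d + Real.log (1 / η))) ≤ X) :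
    ((2 * d : ℝ) ^ (K * q + 1) + d) * Real.exp (-X) ≤ (1 / 2) ^ p * η := by
  have hd : 0 ≤ Real.log d := Real.log_natCast_nonneg d
  have ha : 0 ≤ Real.log (1 / η) := Real.log_nonneg ((one_le_div hη).2 hη1)
  have hexp : Real.exp (-(Real.log d + Real.log (1 / η))) ≤ η := by
    rw [← exp_neg_log_one_div hη, one_div, Real.exp_le_exp, ← one_div, exp_neg_log_one_div hη]
    linarith
  set L := Real.log d + Real.log (1 / η)
  have hL0 : 0 ≤ L := add_nonneg hd ha
  have hhalf : Real.exp (-L) ≤ 1 / 2 := by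
    rw [Real.exp_neg, one_div]
    exact inv_anti₀ two_pos ((Real.log_le_iff_le_exp two_pos).1 hL)
  have hqL : (p + 4) * L ≤ (p + 4) * (q * L) := by
    gcongr
    exact le_mul_of_one_le_left hL0 (by exact_mod_cast hq)
  calc ((2 * d : ℝ) ^ (K * q + 1) + d) * Real.exp (-X)
      ≤ Real.exp ((2 * (K * q : ℕ) + 3) * L) * Real.exp (-X) := by
        gcongr
        exact two_mul_pow_add_le_exp hL (by linarith) _
    _ ≤ Real.exp (p * -L + -L) := by
        rw [← Real.exp_add, Real.exp_le_exp]
        push_cast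
        linarith
    _ = Real.exp (-L) ^ p * Real.exp (-L) := by rw [Real.exp_add, Real.exp_nat_mul]
    _ ≤ (1 / 2) ^ p * η := by gcongr

variable {V Ω : Type*} {N : V → ℕ} {M : ∀ v, Ω → Matrix (Fin (N v)) (Fin d) ℝ}
  [MeasurableSpace Ω] {μ : Measure Ω} {s : Finset V} {r v : V}

lemma lt_measureReal_of_compl_subset [IsProbabilityMeasure μ] {S T : Set Ω} (hST : Sᶜ ⊆ T)
    (hT : μ.real T < ε) : 1 - ε < μ.real S := by
  have hcover : 1 ≤ μ.real S + μ.real T := by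
    rw [← probReal_univ (μ := μ), ← Set.union_compl_self S]
    exact (measureReal_union_le _ _).trans (by gcongr; finiteness)
  linarith

lemma measureReal_exists_mem_le {ι : Type*} {s : Finset ι} {P : ι → Ω → Prop} {b : ℝ}
    (h : ∀ i ∈ s, μ.real {ω | P i ω} ≤ b) : μ.real {ω | ∃ i ∈ s, P i ω} ≤ s.card * b := by
  have hunion : {ω | ∃ i ∈ s, P i ω} = ⋃ i ∈ s, {ω | P i ω} := by
    ext
    simp
  rw [hunion, ← nsmul_eq_mul]
  exact (measureReal_biUnion_finset_le _ _).trans (Finset.sum_le_card_nsmul _ _ _ h)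

lemma measureReal_exists_signedSum_le {k : ℕ} {P : (Fin d → ℝ) → Ω → Prop} {b : ℝ}
    (h : ∀ u, μ.real {ω | P u ω} ≤ b) :
    μ.real {ω | ∃ f : Fin k → Fin d × ℤˣ, P (signedSum f) ω} ≤ (2 * d : ℝ) ^ k * b := by
  simpa [mul_comm] using measureReal_exists_mem_le (s := Finset.univ)
    (P := fun f : Fin k → Fin d × ℤˣ => P (signedSum f)) fun f _ => h (signedSum f)

namespace IsSubGaussianArray

variable (h : IsSubGaussianArray c μ (stackedRows M)) (hc : 0 < c)

include h hc

lemma measureReal_energy_lt_le (v : V) (z : Fin d → ℝ) :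
    μ.real {ω | energy (normalizedDesign M ω v) z < l2NormSq z / 4} ≤
      Real.exp (-(energyRate c * N v)) := by
  have := h.measureReal_sum_energy_lt_le hc (s := {v}) (N₀ := N v) (by simp) z
  simpa [div_eq_inv_mul] using this

lemma measureReal_lt_energy_le (v : V) (z : Fin d → ℝ) :
    μ.real {ω | energyBound c * l2NormSq z < energy (normalizedDesign M ω v) z} ≤
      Real.exp (-(energyRate c * N v)) := by
  have := h.measureReal_lt_sum_energy_le hc (s := {v}) (N₀ := N v) (by simp) z
  simpa using this

lemma measureReal_not_restrictedLowerBound_le (hθ : 0 < θ) (m : ℕ) (v : V) :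
    μ.real {ω | ¬ RestrictedLowerBound (energy (normalizedDesign M ω v)) θ m} ≤
      ((2 * d : ℝ) ^ (maureyLength c θ * m + 1) + d) * Real.exp (-(energyRate c * N v)) := by
  have := h.indep.isProbabilityMeasure
  have hsum := measureReal_exists_signedSum_le (k := maureyLength c θ * m + 1)
    (h.measureReal_energy_lt_le hc v)
  have hcol := measureReal_exists_mem_le (s := Finset.univ) fun (j : Fin d) _ =>
    h.measureReal_lt_energy_le hc v (Pi.single j 1)
  rw [Finset.card_fin] at hcol
  rw [add_mul]
  refine (measureReal_mono fun ω hω => ?_).trans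
    ((measureReal_union_le _ _).trans (add_le_add hsum hcol))
  contrapose! hω
  simp only [Set.mem_union, Set.mem_ofPred_eq, Finset.mem_univ, true_and, l2NormSq_single,
    mul_one, not_or, not_exists, not_lt] at hω
  simpa using restrictedLowerBound_of_signedSum (maureyLength_pos c hθ)
    (le_maureyLength_mul c hθ) hω.1 hω.2

lemma measureReal_not_restrictedUpperBound_le (hθ : 0 < θ) {N₀ : ℝ} (hN : ∀ v ∈ s, N₀ ≤ N v)
    (m : ℕ) :
    μ.real {ω | ¬ RestrictedUpperBound (∑ v ∈ s, energy (normalizedDesign M ω v))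
      (energyBound c * s.card) θ m} ≤
      (2 * d : ℝ) ^ (maureyLength c θ * m + 1) * Real.exp (-(energyRate c * s.card * N₀)) := by
  have := h.indep.isProbabilityMeasure
  have hB := one_le_energyBound c
  refine (measureReal_mono fun ω hω => ?_).trans (measureReal_exists_signedSum_le
    (h.measureReal_lt_sum_energy_le hc hN))
  contrapose! hω
  simp only [Set.mem_ofPred_eq, not_exists, not_lt] at hω
  simp only [Set.mem_ofPred_eq, not_not]
  refine restrictedUpperBound_of_signedSum (maureyLength_pos c hθ)
    (le_trans (by linarith) (le_maureyLength_mul c hθ)) (by positivity) (fun u => ?_) fun f => ?_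
  · rw [sum_apply]
    exact Finset.sum_nonneg fun v _ => energy_nonneg _ _
  · rw [sum_apply]
    exact hω f

lemma measureReal_not_restrictedLowerBound_le_of_sampleFactor (hθ : 0 < θ) (hη : 0 < η)
    (hη1 : η ≤ 1) (hL : Real.log 2 ≤ Real.log d + Real.log (1 / η))
    (hN : sampleFactor c θ p * (m * (Real.log d + Real.log (1 / η))) ≤ N v) :
    μ.real {ω | ¬ RestrictedLowerBound (energy (normalizedDesign M ω v)) θ m} ≤
      (1 / 2) ^ p * η := by
  rcases m.eq_zero_or_pos with rfl | hm
  · simp only [restrictedLowerBound_zero_right hθ.le, not_true_eq_false, Set.ofPred_false,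
      measureReal_empty]
    positivity
  refine (h.measureReal_not_restrictedLowerBound_le hc hθ m v).trans
    (two_mul_pow_add_mul_exp_le hm hη hη1 hL ?_)
  have hL0 := (Real.log_nonneg one_le_two).trans hL
  exact (le_mul_of_one_le_left (by positivity) one_le_two).trans (two_mul_le_energyRate_mul hc hN)

lemma measureReal_not_restrictedUpperBound_le_of_sampleFactor (hθ : 0 < θ) (hη : 0 < η)
    (hη1 : η ≤ 1) (hL : Real.log 2 ≤ Real.log d + Real.log (1 / η)) {n : ℕ} (hn : 0 < n)
    (hns : n ≤ 2 * s.card)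
    (hN : ∀ v ∈ s, sampleFactor c θ p * (n * m * (Real.log d + Real.log (1 / η))) ≤ N v) :
    μ.real {ω | ¬ RestrictedUpperBound (∑ v ∈ s, energy (normalizedDesign M ω v))
      (energyBound c * s.card) θ (n ^ 2 * m)} ≤ (1 / 2) ^ p * η := by
  rcases m.eq_zero_or_pos with rfl | hm
  · have hB : 0 ≤ energyBound c * s.card :=
      mul_nonneg (by linarith [one_le_energyBound c]) s.card.cast_nonneg
    simp only [mul_zero, restrictedUpperBound_zero_right hB hθ.le, not_true_eq_false,
      Set.ofPred_false, measureReal_empty]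
    positivity
  refine (h.measureReal_not_restrictedUpperBound_le hc hθ hN _).trans <| le_trans
    (mul_le_mul_of_nonneg_right (le_add_of_nonneg_right d.cast_nonneg) (Real.exp_pos _).le)
    (two_mul_pow_add_mul_exp_le (by positivity) hη hη1 hL ?_)
  have hns' : (n : ℝ) ≤ 2 * s.card := by exact_mod_cast hns
  have hL0 := (Real.log_nonneg one_le_two).trans hL
  set L := Real.log d + Real.log (1 / η)
  push_cast
  calc (2 * maureyLength c θ + p + 4) * (n ^ 2 * m * L)
      = n * ((2 * maureyLength c θ + p + 4) * (n * m * L)) := by ring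
    _ ≤ 2 * s.card * ((2 * maureyLength c θ + p + 4) * (n * m * L)) := by gcongr
    _ = s.card * (2 * ((2 * maureyLength c θ + p + 4) * (n * m * L))) := by ring
    _ ≤ s.card * (energyRate c * (sampleFactor c θ p * (n * m * L))) :=
        mul_le_mul_of_nonneg_left (two_mul_le_energyRate_mul hc le_rfl) s.card.cast_nonneg
    _ = energyRate c * s.card * (sampleFactor c θ p * (n * m * L)) := by ring

lemma measureReal_not_restrictedLowerBound_le_of_subsingleton [Subsingleton (Fin d)] (hθ : 0 ≤ θ)
    (m : ℕ) (v : V) :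
    μ.real {ω | ¬ RestrictedLowerBound (energy (normalizedDesign M ω v)) θ m} ≤
      Real.exp (-(energyRate c * N v)) := by
  have := h.indep.isProbabilityMeasure
  refine (measureReal_mono fun ω hω => ?_).trans (h.measureReal_energy_lt_le hc v 1)
  contrapose! hω
  simp only [Set.mem_ofPred_eq, not_lt, not_not] at hω ⊢
  exact restrictedLowerBound_of_subsingleton hθ hω

lemma measureReal_not_restrictedLowerBound_le_of_subsingleton_of_sampleFactor
    [Subsingleton (Fin d)] (hθ : 0 ≤ θ) (hm : 0 < m) (hε : 0 < ε) (hε1 : ε < 1)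
    (hN : sampleFactor c θ p * (m * (Real.log d + Real.log (1 / ε))) ≤ N r) :
    μ.real {ω | ¬ RestrictedLowerBound (energy (normalizedDesign M ω r)) θ m} ≤
      Real.exp (-(energyRate c / 2)) * ε := by
  have hγ := energyRate_pos hc
  have hlog : 0 < Real.log (1 / ε) := Real.log_pos ((one_lt_div hε).2 hε1)
  have hd := Real.log_natCast_nonneg d
  have hN1 : (1 : ℝ) ≤ N r := by
    have := sampleFactor_pos hc θ p
    have : (0 : ℝ) < N r := lt_of_lt_of_le (by positivity) hN
    exact_mod_cast this
  have hN2 : 2 * Real.log (1 / ε) ≤ energyRate c * N r := by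
    refine le_trans ?_ (two_mul_le_energyRate_mul hc hN)
    gcongr
    calc Real.log (1 / ε) ≤ Real.log d + Real.log (1 / ε) := le_add_of_nonneg_left hd
      _ ≤ m * (Real.log d + Real.log (1 / ε)) :=
          le_mul_of_one_le_left (by positivity) (by exact_mod_cast hm)
      _ ≤ (2 * maureyLength c θ + p + 4) * (m * (Real.log d + Real.log (1 / ε))) :=
          le_mul_of_one_le_left (by positivity)
            (by linarith [(maureyLength c θ).cast_nonneg (α := ℝ), p.cast_nonneg (α := ℝ)])
  calc _ ≤ Real.exp (-(energyRate c * N r)) :=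
        h.measureReal_not_restrictedLowerBound_le_of_subsingleton hc hθ m r
    _ ≤ Real.exp (-(energyRate c / 2) + -Real.log (1 / ε)) :=
        Real.exp_le_exp.2 (by linarith [le_mul_of_one_le_right hγ.le hN1])
    _ = Real.exp (-(energyRate c / 2)) * ε := by rw [Real.exp_add, exp_neg_log_one_div hε]

lemma measureReal_not_restrictedLowerBound_root_le (hθ : 0 < θ)
    (hp : (1 / 2) ^ p ≤ Real.exp (-(energyRate c / 2))) (hε : 0 < ε) (hε1 : ε < 1)
    (hN : sampleFactor c θ p * (m * (Real.log d + Real.log (1 / ε))) ≤ N r) :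
    μ.real {ω | ¬ RestrictedLowerBound (energy (normalizedDesign M ω r)) θ m} ≤
      Real.exp (-(energyRate c / 2)) * ε := by
  rcases m.eq_zero_or_pos with rfl | hm
  · simp only [restrictedLowerBound_zero_right hθ.le, not_true_eq_false, Set.ofPred_false,
      measureReal_empty]
    positivity
  rcases le_or_gt (Real.log 2) (Real.log d + Real.log (1 / ε)) with hL | hL
  · exact (h.measureReal_not_restrictedLowerBound_le_of_sampleFactor hc hθ hε hε1.le hL hN).trans
      (mul_le_mul_of_nonneg_right hp hε.le)
  -- Now `d ≤ 1` and `ε` may be near `1`: `N r` cannot pay for a union bound, but none is needed.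
  have hd : d ≤ 1 := by
    by_contra! hd
    have := Real.log_le_log two_pos (show (2 : ℝ) ≤ d by exact_mod_cast hd)
    linarith [Real.log_pos ((one_lt_div hε).2 hε1)]
  have : Subsingleton (Fin d) := Fin.subsingleton_iff_le_one.2 hd
  exact h.measureReal_not_restrictedLowerBound_le_of_subsingleton_of_sampleFactor hc hθ.le hm hε
    hε1 hN

open Classical in
lemma measureReal_not_restrictedBounds_erase_le [Fintype V] (hθ : 0 < θ) (hε : 0 < ε)
    (hε1 : ε < 1) (hN : ∀ v, v ≠ r → sampleFactor c θ p *
      (Fintype.card V * m * (Real.log d + Real.log (Fintype.card V / ε))) ≤ N v) :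
    μ.real ({ω | ∃ v ∈ Finset.univ.erase r,
        ¬ RestrictedLowerBound (energy (normalizedDesign M ω v)) θ m} ∪
      {ω | ¬ RestrictedUpperBound (∑ v ∈ Finset.univ.erase r, energy (normalizedDesign M ω v))
        (energyBound c * (Finset.univ.erase r).card) θ (Fintype.card V ^ 2 * m)}) ≤
      (1 / 2) ^ p * ε := by
  rcases subsingleton_or_nontrivial V with hV | hV
  · have hempty : Finset.univ.erase r = ∅ := by
      ext v
      simp [Subsingleton.elim v r]
    have hB : 0 ≤ energyBound c * (∅ : Finset V).card := by simp
    simp only [hempty, Finset.notMem_empty, false_and, exists_false, Set.ofPred_false,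
      Finset.sum_empty, restrictedUpperBound_zero_left hB hθ.le, not_true_eq_false, Set.union_empty,
      measureReal_empty]
    positivity
  have hcard : (Finset.univ.erase r).card + 1 = Fintype.card V :=
    Finset.card_erase_add_one (Finset.mem_univ r)
  have hn2 : 2 ≤ Fintype.card V := Fintype.one_lt_card
  set n := Fintype.card V
  have hn2' : (2 : ℝ) ≤ n := by exact_mod_cast hn2
  have hη : ε / n ≤ 1 / 2 := by gcongr
  have hη0 : 0 < ε / n := by positivity
  have hL : Real.log 2 ≤ Real.log d + Real.log (1 / (ε / n)) := by
    have hlog := Real.log_le_log two_pos ((le_one_div two_pos hη0).2 hη)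
    linarith [Real.log_natCast_nonneg d]
  simp only [← one_div_div ε] at hN
  have hnode := measureReal_exists_mem_le (s := Finset.univ.erase r) fun v hv =>
    h.measureReal_not_restrictedLowerBound_le_of_sampleFactor hc (m := m) hθ hη0
      (hη.trans (by norm_num)) hL <| le_trans (by
        have := sampleFactor_pos hc θ p
        have := (Real.log_nonneg one_le_two).trans hL
        gcongr
        exact le_mul_of_one_le_left m.cast_nonneg (by linarith)) (hN v (Finset.ne_of_mem_erase hv))
  have houter := h.measureReal_not_restrictedUpperBound_le_of_sampleFactor hc (m := m)
    (s := Finset.univ.erase r) hθ hη0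
    (hη.trans (by norm_num)) hL (by lia) (by lia) fun v hv => hN v (Finset.ne_of_mem_erase hv)
  refine (measureReal_union_le _ _).trans ((add_le_add hnode houter).trans_eq ?_)
  rw [← add_one_mul, mul_left_comm]
  congr 1
  have hcard' : ((Finset.univ.erase r).card + 1 : ℝ) = n := by exact_mod_cast hcard
  rw [hcard', mul_div_cancel₀ _ (by positivity)]

end IsSubGaussianArray

end UnionBound

section SubGaussianFamily

variable {V Ω : Type*} [MeasurableSpace Ω] {N : V → ℕ} {d : ℕ} {β κ : ℝ} {μ : Measure Ω}
  {M : ∀ v, Ω → Matrix (Fin (N v)) (Fin d) ℝ}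

/-- A variance proxy for centred random variables with tails `P(|X| ≥ t) ≤ β exp(-κ t²)`. -/
noncomputable def subGaussianConst (β κ : ℝ) : NNReal :=
  (2 * (1 + max β 1) / (κ / 2)).toNNReal

lemma subGaussianConst_pos (β : ℝ) (hκ : 0 < κ) : 0 < subGaussianConst β κ :=
  Real.toNNReal_pos.2 (by positivity)

lemma IsSubGaussianFamily.isSubGaussianArray (h : IsSubGaussianFamily β κ μ M) (hκ : 0 < κ) :
    IsSubGaussianArray (subGaussianConst β κ) μ (stackedRows M) where
  indep := by
    have hinj : Function.Injective fun p : (Σ v, Fin (N v)) × Fin d =>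
        (⟨p.1.1, (p.1.2, p.2)⟩ : Σ v, Fin (N v) × Fin d) := by
      rintro ⟨⟨v, i⟩, j⟩ ⟨⟨v', i'⟩, j'⟩ hp
      simp only [Sigma.mk.injEq] at hp
      obtain ⟨rfl, hp⟩ := hp
      simp only [heq_eq_eq, Prod.mk.injEq] at hp
      obtain ⟨rfl, rfl⟩ := hp
      rfl
    exact h.indep.precomp hinj
  subgaussian p j := by
    have := h.indep.isProbabilityMeasure
    have hβ : 1 ≤ max β 1 := le_max_right β 1
    have hmoment : HasExpSqMoment (fun ω => M p.1 ω p.2 j) (κ / 2) (1 + max β 1) μ :=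
      .of_tail (h.identDistrib p.1 p.2 j p.2 j).aemeasurable_fst (by linarith) hκ fun t ht =>
        (h.tail p.1 p.2 j t ht).trans <| by
          gcongr
          exact le_max_left β 1
    exact hmoment.hasSubgaussianMGF (by positivity) (by linarith) (h.mean_zero _ _ _)
  mean_zero p j := h.mean_zero _ _ _
  variance_one p j := h.variance_one _ _ _

end SubGaussianFamily

theorem theorem1_general (c : NNReal) (hc : 0 < c) :
    ∃ C : ℝ, 0 < C ∧
      ∀ (V : Type*) [Fintype V] (G : SimpleGraph V) (r : V) (d s s' : ℕ)
        (x : V → Fin d → ℝ) (N : V → ℕ)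
        (Ω : Type*) [MeasurableSpace Ω] (μ : Measure Ω)
        (M : ∀ v, Ω → Matrix (Fin (N v)) (Fin d) ℝ) (ε : ℝ),
        G.Connected →
        IsGraphSparse G r s s' x →
        IsSubGaussianArray c μ (stackedRows M) →
        0 < ε → ε < 1 →
        C * (max (s : ℝ) ((Fintype.card V : ℝ) ^ 2 * G.diam * s') *
          (Real.log d + Real.log (1 / ε))) ≤ N r →
        (∀ v, v ≠ r →
          C * ((Fintype.card V : ℝ) * G.diam * s' *
            (Real.log d + Real.log (Fintype.card V / ε))) ≤ N v) →
        1 - ε < μ.real {ω | ∀ z : V → Fin d → ℝ,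
          IsTVBPSolution (SimpleGraph.starGraph r) r (normalizedDesign M ω)
            (fun v => (normalizedDesign M ω v).mulVec (x v)) z ↔ z = x} := by
  have hB := one_le_energyBound c
  have hexp : Real.exp (-(energyRate c / 2)) < 1 := by
    simpa using energyRate_pos hc
  obtain ⟨p, hp⟩ := exists_pow_lt_of_lt_one
    (lt_min (Real.exp_pos (-(energyRate c / 2))) (sub_pos.2 hexp)) one_half_lt_one
  obtain ⟨hp_root, hp_node⟩ := lt_min_iff.1 hp
  set θ := 1 / (200 * energyBound c)
  have hθ0 : 0 < θ := by positivity
  refine ⟨sampleFactor c θ p, sampleFactor_pos hc θ p, ?_⟩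
  intro V _ G r d s s' x N Ω _ μ M ε hG hx hM hε hε1 hNr hN
  classical
  have := hM.indep.isProbabilityMeasure
  have hroot := hM.measureReal_not_restrictedLowerBound_root_le hc
    (m := max s (Fintype.card V ^ 2 * (G.diam * s'))) hθ0 hp_root.le hε hε1
    (by simpa [mul_assoc] using hNr)
  have hnode := hM.measureReal_not_restrictedBounds_erase_le hc (m := G.diam * s') (p := p)
    hθ0 hε hε1 (by simpa [mul_assoc] using hN)
  refine lt_measureReal_of_compl_subset (fun ω hω => ?_)
    (((measureReal_union_le _ _).trans (add_le_add hroot hnode)).trans_lt (by nlinarith))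
  contrapose! hω
  simp only [Set.mem_union, Set.mem_ofPred_eq, not_or, not_exists, not_and, not_not,
    Finset.mem_erase, Finset.mem_univ, and_true, Set.mem_compl_iff] at hω ⊢
  obtain ⟨hω_root, hω_node, hω_out⟩ := hω
  exact fun z => isTVBPSolution_iff_eq fun z hz hobj =>
    eq_of_restrictedBounds hB (mul_one_div_cancel (by positivity)).le hω_root hω_node hω_out
      (le_max_right _ _) (hx.1.trans (le_max_left _ _)) (fun v => hx.ncard_supp_sub_le hG v r)
      hz hobj

theorem theorem1 (β κ : ℝ) (hκ : 0 < κ) :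
    ∃ C : ℝ, 0 < C ∧
      ∀ (V : Type*) [Fintype V] (G : SimpleGraph V) (r : V) (d s s' : ℕ)
        (x : V → Fin d → ℝ) (N : V → ℕ)
        (Ω : Type*) [MeasurableSpace Ω] (μ : Measure Ω) [IsProbabilityMeasure μ]
        (M : ∀ v, Ω → Matrix (Fin (N v)) (Fin d) ℝ) (ε : ℝ),
        G.Connected →
        IsGraphSparse G r s s' x →
        IsSubGaussianFamily β κ μ M →
        0 < ε → ε < 1 →
        C * (max (s : ℝ) ((Fintype.card V : ℝ) ^ 2 * G.diam * s') *
          (Real.log d + Real.log (1 / ε))) ≤ N r →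
        (∀ v, v ≠ r →
          C * ((Fintype.card V : ℝ) * G.diam * s' *
            (Real.log d + Real.log (Fintype.card V / ε))) ≤ N v) →
        1 - ε < μ.real {ω | ∀ z : V → Fin d → ℝ,
          IsTVBPSolution (SimpleGraph.starGraph r) r (normalizedDesign M ω)
            (fun v => (normalizedDesign M ω v).mulVec (x v)) z ↔ z = x} := by
  obtain ⟨C, hC, hrec⟩ := theorem1_general _ (subGaussianConst_pos β hκ)
  exact ⟨C, hC, fun V _ G r d s s' x N Ω _ μ _ M ε hG hx hM =>
    hrec V G r d s s' x N Ω μ M ε hG hx (hM.isSubGaussianArray hκ)⟩
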